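/- Let $\Omega\subset\mathbb R^d$ be compact and satisfy an interior cone condition: there are $\theta\in(0,\pi/2)$ and $r>0$ such that for every $x\in\Omega$ there is a unit vector $\xi(x)$ with $x+ty\in\Omega$ whenever $\|y\|_2=1$, $y^T\xi(x)\ge\cos\theta$ and $0\le t\le r$. Let $\Phi_2:\Omega\times\Omega\to\mathbb R$ be a continuous symmetric positive definite kernel, i.e. $\sum_{i,j=1}^n\Phi_2(x_i,x_j)c_ic_j>0$ for all pairwise distinct $x_1,\dots,x_n\in\Omega$ and all $c\in\mathbb R^n\setminus\{0\}$. Let $(\lambda_k,e_k)_{k\in\mathbb N}$ be a complete system of positive eigenvalues and continuous $L_2(\Omega)$-orthonormal eigenfunctions of the integral operator $Tg=\int_\Omega\Phi_2(\cdot,y)g(y)\,dy$ (complete: $Tg=0$ for every $g\in L_2(\Omega)$ orthogonal to all $e_k$). Put $\phi_k:=\lambda_k^{1/2}e_k$ and suppose that $\sum_k|\phi_k(x)|<\infty$ for all $x\in\Omega$. For $m\ge2$ let $$\Phi_m(z_1,\dots,z_m):=\sum_{k}\prod_{i=1}^m\phi_k(z_i),\qquad z_1,\dots,z_m\in\Omega,$$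 and for $1<p<\infty$ let $\mathcal B^p$ be the space of all functions $\sum_k\alpha_k\phi_k$ on $\Omega$ with $\alpha\in\ell^p$. Let $m$ be a positive even integer, $f\in\mathcal B^{m/(m-1)}$ and $\Phi_2\in C^{2\gamma}(\Omega\times\Omega)$ with $\gamma\in\mathbb N$. Then there is a constant $C>0$ such that for every $n\ge1$ and all pairwise distinct points $x_1,\dots,x_n\in\Omega$ the following holds. The multi-linear system $$\sum_{i_2,\dots,i_m=1}^n\Phi_m(x_{i_1},x_{i_2},\dots,x_{i_m})c_{i_2}\cdots c_{i_m}=f(x_{i_1}),\qquad i_1=1,\dots,n,$$ has a unique solution $c\in\mathbb R^n$, and the interpolant $$s_m(x):=\sum_{i_1,\dots,i_{m-1}=1}^n\Phi_m(x,x_{i_1},\dots,x_{i_{m-1}})c_{i_1}\cdots c_{i_{m-1}}$$ satisfies $$|f(x)-s_m(x)|\le C\,h^\gamma\quad\text{for all }x\in\Omega,\qquad h:=\sup_{x\in\Omega}\min_{1\le i\le n}\|x-x_i\|_2.$$ In particular $C$ does not depend on the data points, on $h$ or on $x$. -/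

import Mathlib

open MeasureTheory

noncomputable section

/-- The interior cone condition for a subset of `ℝ^d`: there are an angle `θ ∈ (0, π/2)` and a
radius `r > 0` such that every `x ∈ Ω` is the vertex of a cone with axis some unit vector `ξ`,
opening angle `θ` and radius `r` that lies in `Ω`. -/
def InteriorConeCondition {d : ℕ} (Ω : Set (EuclideanSpace ℝ (Fin d))) : Prop :=
  ∃ θ r : ℝ, 0 < θ ∧ θ < Real.pi / 2 ∧ 0 < r ∧
    ∀ x ∈ Ω, ∃ ξ : EuclideanSpace ℝ (Fin d), ‖ξ‖ = 1 ∧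
      ∀ (y : EuclideanSpace ℝ (Fin d)) (t : ℝ),
        ‖y‖ = 1 → Real.cos θ ≤ inner ℝ y ξ → 0 ≤ t → t ≤ r → x + t • y ∈ Ω

/-- A symmetric positive definite kernel on `Ω`. The quadratic form is strictly positive for
nonzero coefficients at pairwise distinct points. -/
def IsPosDefKernel {d : ℕ} (Ω : Set (EuclideanSpace ℝ (Fin d)))
    (Φ : EuclideanSpace ℝ (Fin d) → EuclideanSpace ℝ (Fin d) → ℝ) : Prop :=
  (∀ x ∈ Ω, ∀ y ∈ Ω, Φ x y = Φ y x) ∧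
  ∀ (n : ℕ) (X : Fin n → EuclideanSpace ℝ (Fin d)), Function.Injective X → (∀ i, X i ∈ Ω) →
    ∀ c : Fin n → ℝ, c ≠ 0 → 0 < ∑ i, ∑ j, Φ (X i) (X j) * c i * c j

/-- `(lam k, e k)` is a complete system of positive eigenvalues and continuous, `L²(Ω)`-orthonormal
eigenfunctions of the integral operator `g ↦ ∫_Ω Φ(·, y) g(y) dy`. Completeness means that the
operator vanishes on the orthogonal complement of the eigenfunctions. -/
structure IsEigenSystem {d : ℕ} (Ω : Set (EuclideanSpace ℝ (Fin d)))
    (Φ : EuclideanSpace ℝ (Fin d) → EuclideanSpace ℝ (Fin d) → ℝ)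
    (lam : ℕ → ℝ) (e : ℕ → EuclideanSpace ℝ (Fin d) → ℝ) : Prop where
  pos : ∀ k, 0 < lam k
  continuousOn : ∀ k, ContinuousOn (e k) Ω
  orthonormal : ∀ j k, ∫ x in Ω, e j x * e k x = if j = k then 1 else 0
  eigen : ∀ k, ∀ x ∈ Ω, ∫ y in Ω, Φ x y * e k y = lam k * e k x
  complete : ∀ g : EuclideanSpace ℝ (Fin d) → ℝ, MemLp g 2 (volume.restrict Ω) →
    (∀ k, ∫ x in Ω, e k x * g x = 0) → ∀ x ∈ Ω, ∫ y in Ω, Φ x y * g y = 0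

/-- The scaled eigenfunctions `φ_k = λ_k^{1/2} e_k`. -/
def featureMap {E : Type*} (lam : ℕ → ℝ) (e : ℕ → E → ℝ) : ℕ → E → ℝ :=
  fun k x => Real.sqrt (lam k) * e k x

/-- The multi-kernel of order `m`, `Φ_m(z_1, …, z_m) = ∑_k ∏_i φ_k(z_i)`. -/
def multiKernel {E : Type*} (φ : ℕ → E → ℝ) (m : ℕ) (z : Fin m → E) : ℝ :=
  ∑' k, ∏ i, φ k (z i)

/-- The space `B^p` of all functions `f = ∑_k α_k φ_k` on `Ω` with `α ∈ ℓ^p`. -/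
def MemRKBS {E : Type*} (Ω : Set E) (φ : ℕ → E → ℝ) (p : ℝ) (f : E → ℝ) : Prop :=
  ∃ α : ℕ → ℝ, Memℓp α (ENNReal.ofReal p) ∧
    ∀ x ∈ Ω, HasSum (fun k => α k * φ k x) (f x)

/-- The full contraction `B c^r = ∑_{j_1, …, j_r} B_{j_1 … j_r} c_{j_1} ⋯ c_{j_r}` of a tensor `B`
of order `r` and dimension `n` with `c ∈ ℝ^n`. -/
def tensorContract {r n : ℕ} (B : (Fin r → Fin n) → ℝ) (c : Fin n → ℝ) : ℝ :=
  ∑ j : Fin r → Fin n, B j * ∏ l, c (j l)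

/-- The tensor-vector product `A c^r ∈ ℝ^n` for a tensor `A` of order `r + 1` and dimension `n`;
the first index is left free. -/
def tensorMulVec {r n : ℕ} (A : (Fin (r + 1) → Fin n) → ℝ) (c : Fin n → ℝ) : Fin n → ℝ :=
  fun i => tensorContract (fun j : Fin r → Fin n => A (Fin.cons i j)) c

/-- The tensor `A_m = (Φ_m(x_{i_1}, …, x_{i_m}))`. -/
def kernelTensor {E : Type*} (φ : ℕ → E → ℝ) (m : ℕ) {n : ℕ} (X : Fin n → E) :
    (Fin m → Fin n) → ℝ :=
  fun i => multiKernel φ m (fun l => X (i l))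

/-- The tensor function `B_m(x) = (Φ_m(x, x_{i_1}, …, x_{i_{m-1}}))`, for `m ≥ 1`
(so that `m - 1 + 1 = m`). -/
def basisTensor {E : Type*} (φ : ℕ → E → ℝ) (m : ℕ) {n : ℕ} (X : Fin n → E) (x : E) :
    (Fin (m - 1) → Fin n) → ℝ :=
  fun j => multiKernel φ (m - 1 + 1) (Fin.cons x (fun l => X (j l)))

/-- The multi-linear system `A_m c^{m-1} = y`, for `m ≥ 1` (so that `m - 1 + 1 = m`). -/
def SolvesSystem {E : Type*} (φ : ℕ → E → ℝ) (m : ℕ) {n : ℕ} (X : Fin n → E)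
    (y : Fin n → ℝ) (c : Fin n → ℝ) : Prop :=
  tensorMulVec (kernelTensor φ (m - 1 + 1) X) c = y

/-- The function `x ↦ B_m(x) c^{m-1}`. -/
def interpolant {E : Type*} (φ : ℕ → E → ℝ) (m : ℕ) {n : ℕ} (X : Fin n → E)
    (c : Fin n → ℝ) (x : E) : ℝ :=
  tensorContract (basisTensor φ m X x) c

/-- The fill distance `h = sup_{x ∈ Ω} min_i ‖x - x_i‖₂`. -/
def fillDistance {d : ℕ} (Ω : Set (EuclideanSpace ℝ (Fin d))) {n : ℕ}
    (X : Fin n → EuclideanSpace ℝ (Fin d)) : ℝ :=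
  ⨆ x : Ω, ⨅ i : Fin n, ‖(x : EuclideanSpace ℝ (Fin d)) - X i‖

end

/-!
For points `X_1, …, X_n` of `Ω` and `c ∈ ℝ^n` put `u_k = ∑_j c_j φ_k(X_j)`. As `φ(x) ∈ ℓ¹` for all
`x ∈ Ω`, the interpolant is `s = ∑_k u_k ^ (m - 1) φ_k` (`hasSum_interpolant`), and the system says
that `s = f` at the data points. With `m` even, this is the Euler equation of the strictly convex
functional `∑_k u_k ^ m - m ∑_i c_i f(X_i)`. Mercer's expansion `Φ(x, y) = ∑_k φ_k(x) φ_k(y)` on `Ω`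
(`hasSum_featureMap_mul`) and positive definiteness show that the sequences `φ(X_j)` are linearly
independent, so the functional is coercive and the system has exactly one solution
(`exists_solution_of_odd`, `solution_unique_of_odd`).

Pairing the system with `c` gives `∑_k u_k ^ m = ∑_k α_k u_k`, where `f = ∑_k α_k φ_k`. By Young's
inequality `∑_k u_k ^ m ≤ ∑_k |α_k| ^ (m / (m - 1))`, a bound independent of the data points. Since
`m / (m - 1) ≤ 2`, the coefficients of `f - s` are bounded in `ℓ²`, so `f - s` is a function of
bounded norm in the reproducing kernel Hilbert space of `Φ` that vanishes at the data points.

It remains to prove the sampling inequality `exists_sampling_bound` for such functions `g`. For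
`x ∈ Ω` there are weights `a_q`, bounded in `ℓ¹`, and data points within `O(h)` of `x` in a cone with
apex `x` such that `L = δ_x - ∑_q a_q δ_{X_q}` annihilates polynomials of degree less than `γ`
(`exists_local_polynomial_reproduction`). Then `g x = L g`, and by the Cauchy–Schwarz inequality
`|L g|²` is at most a constant times `(L ⊗ L) Φ`. As `L ⊗ L` annihilates polynomials in two
variables of total degree less than `2 γ`, only the Taylor remainder of `Φ` of order `2 γ` is left,
and it is `O(h ^ (2 γ))` (`exists_kernel_sum_le_of_annihilates`).

The weights come from compactness rather than from a Markov inequality. Monomial vectors of points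
of an open cone span a finite-dimensional, hence closed, space that contains the monomial vector of
the apex. A basis of nodes stays a basis under small perturbations, with continuous coordinates
(`exists_stable_nodes`), and rotation and scaling transfer this to all cones in `Ω`.

In the proof of Mercer's theorem (`hasSum_mercer`), the completeness of the eigenfunctions shows
that `Φ(x, ·)` is the `L²` sum of its Fourier series; the bound on the diagonal
(`sum_eigen_sq_le_diag`) makes the convergence uniform, so the identity holds at every point.
-/

open MeasureTheory

/-! ### Orthonormal expansions and Mercer's theorem -/

/-- A vector orthogonal to the orthogonal complement of an orthonormal sequence is the sum of its
Fourier series. -/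
theorem hasSum_inner_smul_of_orthogonal {H : Type*} [NormedAddCommGroup H] [InnerProductSpace ℝ H]
    [CompleteSpace H] {E : ℕ → H} (hE : Orthonormal ℝ E) (v : H)
    (hv : ∀ w : H, (∀ k, inner ℝ (E k) w = 0) → inner ℝ v w = 0) :
    HasSum (fun k => inner ℝ (E k) v • E k) v := by
  have hs : Summable fun k => inner ℝ (E k) v • E k := by
    have h := (hE.orthogonalFamily.summable_iff_norm_sq_summable
      (fun k => (inner ℝ (E k) v : ℝ))).2 (hE.inner_products_summable v)
    simpa using h
  have hort : ∀ j, inner ℝ (E j) (v - ∑' k, inner ℝ (E k) v • E k) = 0 := by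
    intro j
    rw [inner_sub_right, sub_eq_zero]
    have h1 := hs.hasSum.mapL (innerSL ℝ (E j))
    have h2 : HasSum (fun k => innerSL ℝ (E j) (inner ℝ (E k) v • E k)) (inner ℝ (E j) v) := by
      convert hasSum_ite_eq j (inner ℝ (E j) v : ℝ) using 2 with k
      rw [innerSL_apply_apply, inner_smul_right, orthonormal_iff_ite.1 hE]
      rcases eq_or_ne k j with rfl | h
      · simp
      · simp [h, h.symm]
    exact h2.unique h1
  have hz : v - ∑' k, inner ℝ (E k) v • E k = 0 := by
    rw [← inner_self_eq_zero (𝕜 := ℝ)]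
    nth_rewrite 1 [inner_sub_left]
    rw [hv _ hort, zero_sub, neg_eq_zero, real_inner_comm]
    have h1 := hs.hasSum.mapL (innerSL ℝ (v - ∑' k, inner ℝ (E k) v • E k))
    refine h1.unique ?_
    convert hasSum_zero with k
    rw [innerSL_apply_apply, inner_smul_right, real_inner_comm _ (v - _), hort, mul_zero]
  rw [sub_eq_zero] at hz
  nth_rewrite 2 [hz]
  exact hs.hasSum

section Mercer

variable {X : Type*} [TopologicalSpace X] [CompactSpace X] [MeasurableSpace X] [BorelSpace X]
  (μ : Measure X) [IsFiniteMeasure μ]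

variable {μ} in
theorem inner_toLp_eq_integral (a : C(X, ℝ)) (w : Lp ℝ 2 μ) :
    inner ℝ (ContinuousMap.toLp (E := ℝ) 2 μ ℝ a) w = ∫ y, a y * w y ∂μ := by
  rw [L2.inner_def]
  refine integral_congr_ae ?_
  filter_upwards [ContinuousMap.coeFn_toLp (p := 2) (𝕜 := ℝ) μ a] with y hy
  rw [hy]; simp [mul_comm]

variable {μ} in
theorem inner_toLp_toLp_eq_integral (a b : C(X, ℝ)) :
    inner ℝ (ContinuousMap.toLp (E := ℝ) 2 μ ℝ a) (ContinuousMap.toLp (E := ℝ) 2 μ ℝ b)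
      = ∫ y, a y * b y ∂μ := by
  rw [ContinuousMap.inner_toLp]; simp [mul_comm]

/-- Diagonal bound for the partial sums of the Mercer series. Otherwise the remainder kernel
would be uniformly negative on `B × B` for some neighbourhood `B` of `x`, while its integral
against the indicator of `B × B` is a tail of `∑ λ_k (∫_B e_k)²`. -/
theorem sum_eigen_sq_le_diag [μ.IsOpenPosMeasure] (Φ : C(X × X, ℝ)) (lam : ℕ → ℝ) (e : ℕ → C(X, ℝ))
    (hpos : ∀ k, 0 < lam k)
    (horth : ∀ j k, ∫ x, e j x * e k x ∂μ = if j = k then 1 else 0)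
    (heig : ∀ k x, ∫ y, Φ (x, y) * e k y ∂μ = lam k * e k x)
    (hcomp : ∀ g : Lp ℝ 2 μ, (∀ k, ∫ x, e k x * g x ∂μ = 0) → ∀ x, ∫ y, Φ (x, y) * g y ∂μ = 0)
    (N : ℕ) (x : X) :
    ∑ k ∈ Finset.range N, lam k * e k x * e k x ≤ Φ (x, x) := by
  set T := ContinuousMap.toLp (E := ℝ) 2 μ ℝ
  have hin := inner_toLp_eq_integral (μ := μ)
  have hin2 := inner_toLp_toLp_eq_integral (μ := μ)
  have hE : Orthonormal ℝ (fun k => T (e k)) := by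
    rw [orthonormal_iff_ite]; intro i j; rw [hin2, horth]
  set K : C(X, C(X, ℝ)) := Φ.curry with hK
  by_contra hcon
  push Not at hcon
  set R : X × X → ℝ := fun p => Φ p - ∑ k ∈ Finset.range N, lam k * e k p.1 * e k p.2 with hR
  have hRc : Continuous R := by fun_prop
  obtain ⟨η, hη, hηR⟩ : ∃ η > 0, R (x, x) < -η :=
    ⟨-R (x, x) / 2, by simp only [hR]; linarith, by simp only [hR]; linarith⟩
  have hnhds : {p | R p < -η} ∈ nhds (x, x) := (isOpen_lt hRc continuous_const).mem_nhds hηR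
  rw [nhds_prod_eq, Filter.mem_prod_self_iff] at hnhds
  obtain ⟨B', hB', hBR'⟩ := hnhds
  obtain ⟨B, hBB', hBo, hxB⟩ := mem_nhds_iff.1 hB'
  have hBR : ∀ y ∈ B, ∀ z ∈ B, R (y, z) < -η := fun y hy z hz => hBR' ⟨hBB' hy, hBB' hz⟩
  have hBm : MeasurableSet B := hBo.measurableSet
  have hint : ∀ a : C(X, ℝ), IntegrableOn a B μ := by
    intro a
    exact (a.continuous.integrable_of_hasCompactSupport
      (HasCompactSupport.of_compactSpace _)).integrableOn
  set g : Lp ℝ 2 μ := indicatorConstLp 2 hBm (measure_ne_top μ B) 1 with hg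
  set b : ℕ → ℝ := fun k => ∫ y in B, e k y ∂μ with hb
  let TK : X → Lp ℝ 2 μ := fun y => T (K y)
  have hTKi : IntegrableOn TK B μ :=
    ((T.continuous.comp K.continuous).integrable_of_hasCompactSupport
      (HasCompactSupport.of_compactSpace _)).integrableOn
  -- `∫_B Φ(y, ·) dy` as an element of `L²`; it lies in the closed span of the eigenfunctions
  set V : Lp ℝ 2 μ := ∫ y in B, TK y ∂μ with hV
  have hVin : ∀ w, inner ℝ w V = ∫ y in B, inner ℝ w (TK y) ∂μ := fun w =>
    (integral_inner hTKi w).symm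
  have hVe : ∀ k, inner ℝ (T (e k)) V = lam k * b k := by
    intro k
    rw [hVin, hb]
    simp only
    rw [← integral_const_mul]
    congr 1; ext y
    rw [← heig k y, real_inner_comm, hin2]; rfl
  have hge : ∀ k, inner ℝ g (T (e k)) = b k := by
    intro k
    rw [hg, L2.inner_indicatorConstLp_one]
    refine integral_congr_ae (ae_restrict_of_ae ?_)
    exact ContinuousMap.coeFn_toLp (p := 2) (𝕜 := ℝ) μ (e k)
  have hVsum : HasSum (fun k => lam k * b k * b k) (inner ℝ g V) := by
    have h1 := hasSum_inner_smul_of_orthogonal hE V (by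
      intro w hw
      rw [real_inner_comm, hVin]
      have : ∀ y, inner ℝ w (TK y) = 0 := by
        intro y
        rw [real_inner_comm, hin]
        exact hcomp w (fun k => by rw [← hin]; exact hw k) y
      simp [this])
    have h2 : HasSum (fun k => inner ℝ g (inner ℝ (T (e k)) V • T (e k))) (inner ℝ g V) :=
      h1.mapL (innerSL ℝ g)
    simpa only [inner_smul_right, hVe, hge] using h2
  have hgV : inner ℝ g V = ∫ y in B, ∫ z in B, Φ (y, z) ∂μ ∂μ := by
    rw [hVin]
    congr 1; ext y
    rw [hg, L2.inner_indicatorConstLp_one]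
    refine integral_congr_ae (ae_restrict_of_ae ?_)
    exact ContinuousMap.coeFn_toLp (p := 2) (𝕜 := ℝ) μ (K y)
  have hle : ∑ k ∈ Finset.range N, lam k * b k * b k ≤ inner ℝ g V := by
    refine sum_le_hasSum _ (fun k _ => ?_) hVsum
    rw [mul_assoc]
    exact mul_nonneg (hpos k).le (mul_self_nonneg _)
  have hinner : ∀ y, ∫ z in B, R (y, z) ∂μ
      = (∫ z in B, Φ (y, z) ∂μ) - ∑ k ∈ Finset.range N, lam k * e k y * b k := by
    intro y
    simp only [hR]
    rw [integral_sub (f := fun z => Φ (y, z)) (hint (K y)), integral_finsetSum]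
    · simp only [integral_const_mul]; rfl
    · intro k _
      exact (hint (e k)).const_mul _
    · exact integrable_finsetSum _ fun k _ => (hint (e k)).const_mul _
  have hKB : IntegrableOn (fun y => ∫ z in B, Φ (y, z) ∂μ) B μ := by
    have : (fun y => ∫ z in B, Φ (y, z) ∂μ) = fun y => inner ℝ g (TK y) := by
      ext y
      rw [hg, L2.inner_indicatorConstLp_one]
      refine integral_congr_ae (ae_restrict_of_ae ?_)
      exact (ContinuousMap.coeFn_toLp (p := 2) (𝕜 := ℝ) μ (K y)).symm
    rw [this]
    exact hTKi.const_inner g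
  have hRB : IntegrableOn (fun y => ∫ z in B, R (y, z) ∂μ) B μ := by
    simp only [hinner]
    exact hKB.sub (integrable_finsetSum _ fun k _ => ((hint (e k)).const_mul _).mul_const _)
  have houter : ∫ y in B, ∫ z in B, R (y, z) ∂μ ∂μ
      = inner ℝ g V - ∑ k ∈ Finset.range N, lam k * b k * b k := by
    simp only [hinner]
    rw [integral_sub hKB, integral_finsetSum, hgV]
    · simp only [integral_mul_const, integral_const_mul]; rfl
    · intro k _
      exact ((hint (e k)).const_mul _).mul_const _
    · exact integrable_finsetSum _ fun k _ => ((hint (e k)).const_mul _).mul_const _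
  have hμB : 0 < μ.real B := by
    exact ENNReal.toReal_pos (hBo.measure_pos μ ⟨x, hxB⟩).ne' (measure_ne_top μ B)
  have hup1 : ∀ y ∈ B, ∫ z in B, R (y, z) ∂μ ≤ -η * μ.real B := by
    intro y hy
    have : ∫ z in B, R (y, z) ∂μ ≤ ∫ z in B, (-η) ∂μ :=
      setIntegral_mono_on (hint ⟨fun z => R (y, z), by fun_prop⟩) integrableOn_const hBm
        fun z hz => (hBR y hy z hz).le
    simpa [mul_comm] using this
  have hup : ∫ y in B, ∫ z in B, R (y, z) ∂μ ∂μ ≤ -η * μ.real B * μ.real B := by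
    have : ∫ y in B, ∫ z in B, R (y, z) ∂μ ∂μ ≤ ∫ y in B, (-η * μ.real B) ∂μ :=
      setIntegral_mono_on hRB integrableOn_const hBm hup1
    refine this.trans (le_of_eq ?_)
    simp [mul_comm]
  have : 0 < η * μ.real B * μ.real B := by positivity
  linarith

/-- Mercer's theorem for an integral operator with a complete system of positive eigenvalues. -/
theorem hasSum_mercer [μ.IsOpenPosMeasure] (Φ : C(X × X, ℝ)) (lam : ℕ → ℝ) (e : ℕ → C(X, ℝ))
    (hpos : ∀ k, 0 < lam k)
    (horth : ∀ j k, ∫ x, e j x * e k x ∂μ = if j = k then 1 else 0)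
    (heig : ∀ k x, ∫ y, Φ (x, y) * e k y ∂μ = lam k * e k x)
    (hcomp : ∀ g : Lp ℝ 2 μ, (∀ k, ∫ x, e k x * g x ∂μ = 0) → ∀ x, ∫ y, Φ (x, y) * g y ∂μ = 0)
    (x y : X) :
    HasSum (fun k => lam k * e k x * e k y) (Φ (x, y)) := by
  set T := ContinuousMap.toLp (E := ℝ) 2 μ ℝ
  have hin := inner_toLp_eq_integral (μ := μ)
  have hin2 := inner_toLp_toLp_eq_integral (μ := μ)
  have hE : Orthonormal ℝ (fun k => T (e k)) := by
    rw [orthonormal_iff_ite]; intro i j; rw [hin2, horth]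
  set K : C(X, C(X, ℝ)) := Φ.curry with hK
  have hdiag := sum_eigen_sq_le_diag μ Φ lam e hpos horth heig hcomp
  have hdiagF : ∀ (t : Finset ℕ) (z : X), ∑ k ∈ t, lam k * e k z * e k z ≤ Φ (z, z) := by
    intro t z
    obtain ⟨N, hN⟩ := t.exists_nat_subset_range
    refine (Finset.sum_le_sum_of_subset_of_nonneg hN fun k _ _ => ?_).trans (hdiag N z)
    rw [mul_assoc]; exact mul_nonneg (hpos k).le (mul_self_nonneg _)
  have hM : ∀ z, Φ (z, z) ≤ ‖Φ‖ := fun z => (le_abs_self _).trans (Φ.norm_coe_le_norm (z, z))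
  have hsx : Summable fun k => lam k * e k x * e k x := by
    refine summable_of_sum_le (c := Φ (x, x)) (fun k => ?_) (fun t => hdiagF t x)
    simp only [Pi.zero_apply]
    rw [mul_assoc]; exact mul_nonneg (hpos k).le (mul_self_nonneg _)
  -- the series converges uniformly in the second variable, by the Cauchy–Schwarz inequality
  have hs : Summable fun k => (lam k * e k x) • e k := by
    rw [summable_iff_vanishing_norm]
    intro ε hε
    set M := ‖Φ‖ + 1 with hMd
    have hMp : 0 < M := by positivity
    obtain ⟨s, hs⟩ := summable_iff_vanishing_norm.1 hsx (ε ^ 2 / M) (by positivity)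
    refine ⟨s, fun t ht => ?_⟩
    rw [ContinuousMap.norm_lt_iff _ hε]
    intro z
    have h1 := hs t ht
    rw [Real.norm_eq_abs] at h1 ⊢
    refine abs_lt_of_sq_lt_sq ?_ hε.le
    have h2 : (∑ k ∈ t, lam k * e k x * e k z) ^ 2
        ≤ (∑ k ∈ t, lam k * e k x * e k x) * ∑ k ∈ t, lam k * e k z * e k z := by
      refine Finset.sum_sq_le_sum_mul_sum_of_sq_le_mul _ (fun k _ => ?_) (fun k _ => ?_)
        (fun k _ => ?_)
      · rw [mul_assoc]; exact mul_nonneg (hpos k).le (mul_self_nonneg _)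
      · rw [mul_assoc]; exact mul_nonneg (hpos k).le (mul_self_nonneg _)
      · exact le_of_eq (by ring)
    have h3 : ∑ k ∈ t, lam k * e k z * e k z ≤ M :=
      (hdiagF t z).trans ((hM z).trans (by linarith))
    have h0 : 0 ≤ ∑ k ∈ t, lam k * e k x * e k x := Finset.sum_nonneg fun k _ => by
      rw [mul_assoc]; exact mul_nonneg (hpos k).le (mul_self_nonneg _)
    rw [abs_of_nonneg h0] at h1
    have h4 : (∑ k ∈ t, (lam k * e k x) • e k) z = ∑ k ∈ t, lam k * e k x * e k z := by
      simp [ContinuousMap.sum_apply]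
    rw [h4]
    calc _ ≤ _ := h2
      _ ≤ (∑ k ∈ t, lam k * e k x * e k x) * M := by gcongr
      _ < ε ^ 2 / M * M := by gcongr
      _ = ε ^ 2 := by field_simp
  have h1 := hs.hasSum.mapL T
  have h2 : HasSum (fun k => T ((lam k * e k x) • e k)) (T (K x)) := by
    have := hasSum_inner_smul_of_orthogonal hE (T (K x)) (by
      intro w hw
      rw [hin]
      exact hcomp w (fun k => by rw [← hin]; exact hw k) x)
    convert this using 2 with k
    rw [map_smul, ← heig k x, real_inner_comm, hin2]; rfl
  have h3 : ∑' k, (lam k * e k x) • e k = K x :=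
    ContinuousMap.toLp_injective (p := 2) (𝕜 := ℝ) μ (h1.unique h2)
  have h4 := hs.hasSum.mapL (ContinuousMap.evalCLM ℝ y)
  rw [h3] at h4
  exact h4

end Mercer

/-! ### Cones and the domain -/

section Cone

variable {E : Type*} [NormedAddCommGroup E] [InnerProductSpace ℝ E]

/-- The open round cone with apex `0` (not included), axis `ξ` and radius `r`; the parameter `c`
is the cosine of the opening angle. -/
def roundCone (c r : ℝ) (ξ : E) : Set E :=
  {y | ‖y‖ < r ∧ c * ‖y‖ < inner ℝ y ξ}

theorem isOpen_roundCone (c r : ℝ) (ξ : E) : IsOpen (roundCone c r ξ) :=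
  (isOpen_lt continuous_norm continuous_const).inter
    (isOpen_lt (continuous_const.mul continuous_norm) (continuous_id.inner continuous_const))

theorem convex_roundCone {c : ℝ} (hc : 0 ≤ c) (r : ℝ) (ξ : E) : Convex ℝ (roundCone c r ξ) := by
  intro x hx y hy a b ha hb hab
  have hn : ‖a • x + b • y‖ ≤ a * ‖x‖ + b * ‖y‖ := by
    refine (norm_add_le _ _).trans (le_of_eq ?_)
    rw [norm_smul, norm_smul, Real.norm_of_nonneg ha, Real.norm_of_nonneg hb]
  have key : ∀ p q p' q' : ℝ, p < p' → q < q' → a * p + b * q < a * p' + b * q' := by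
    intro p q p' q' h1 h2
    rcases ha.eq_or_lt with rfl | ha
    · have : b = 1 := by linarith
      subst this; linarith
    · have h3 := mul_lt_mul_of_pos_left h1 ha
      have h4 := mul_le_mul_of_nonneg_left h2.le hb
      linarith
  constructor
  · have := key _ _ _ _ hx.1 hy.1
    have h2 : a * r + b * r = r := by rw [← add_mul, hab, one_mul]
    linarith
  · have := key _ _ _ _ hx.2 hy.2
    rw [inner_add_left, real_inner_smul_left, real_inner_smul_left]
    have h2 := mul_le_mul_of_nonneg_left hn hc
    linarith

theorem smul_mem_roundCone {c r R : ℝ} {ξ y : E} (hR : 0 < R) (hy : y ∈ roundCone c r ξ) :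
    R • y ∈ roundCone c (R * r) ξ := by
  constructor
  · rw [norm_smul, Real.norm_of_nonneg hR.le]
    exact mul_lt_mul_of_pos_left hy.1 hR
  · rw [norm_smul, Real.norm_of_nonneg hR.le, real_inner_smul_left, mul_left_comm]
    exact mul_lt_mul_of_pos_left hy.2 hR

theorem roundCone_mono {c r R : ℝ} (h : r ≤ R) (ξ : E) : roundCone c r ξ ⊆ roundCone c R ξ :=
  fun _ hy => ⟨hy.1.trans_le h, hy.2⟩

theorem zero_mem_closure_roundCone {c r : ℝ} (hc : c < 1) (hr : 0 < r) {ξ : E} (hξ : ‖ξ‖ = 1) :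
    (0 : E) ∈ closure (roundCone c r ξ) := by
  have h1 : Filter.Tendsto (fun t : ℝ => t • ξ) (nhdsWithin 0 (Set.Ioi 0)) (nhds 0) := by
    have : ContinuousAt (fun t : ℝ => t • ξ) 0 := by fun_prop
    simpa using this.tendsto.mono_left nhdsWithin_le_nhds
  refine mem_closure_of_tendsto h1 ?_
  filter_upwards [Ioo_mem_nhdsGT hr] with t ht
  constructor
  · rw [norm_smul, hξ, Real.norm_of_nonneg ht.1.le]; linarith [ht.2]
  · rw [norm_smul, hξ, Real.norm_of_nonneg ht.1.le, real_inner_smul_left,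
      real_inner_self_eq_norm_sq, hξ]
    nlinarith [ht.1]

theorem roundCone_nonempty {c r : ℝ} (hc : c < 1) (hr : 0 < r) {ξ : E} (hξ : ‖ξ‖ = 1) :
    (roundCone c r ξ).Nonempty :=
  closure_nonempty_iff.1 ⟨0, zero_mem_closure_roundCone hc hr hξ⟩

theorem LinearIsometryEquiv.map_mem_roundCone (O : E ≃ₗᵢ[ℝ] E) {c r : ℝ} {ξ y : E}
    (hy : y ∈ roundCone c r ξ) : O y ∈ roundCone c r (O ξ) := by
  refine ⟨?_, ?_⟩
  · rw [O.norm_map]; exact hy.1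
  · rw [O.norm_map, O.inner_map_map]; exact hy.2

/-- Every point of `Ω` is the apex of an open round cone of fixed size contained in `Ω`. -/
def HasInteriorCones (c r : ℝ) (Ω : Set E) : Prop :=
  ∀ x ∈ Ω, ∃ ξ : E, ‖ξ‖ = 1 ∧ ∀ y ∈ roundCone c r ξ, x + y ∈ Ω

theorem HasInteriorCones.exists_convex {c r : ℝ} {Ω : Set E} (h : HasInteriorCones c r Ω)
    (hc0 : 0 ≤ c) (hc : c < 1) (hr : 0 < r) {x : E} (hx : x ∈ Ω) :
    ∃ U ⊆ Ω, Convex ℝ U ∧ IsOpen U ∧ U.Nonempty ∧ x ∈ closure U := by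
  obtain ⟨ξ, hξ, hU⟩ := h x hx
  refine ⟨(x + ·) '' roundCone c r ξ, Set.image_subset_iff.2 hU, ?_, ?_, ?_, ?_⟩
  · exact (convex_roundCone hc0 r ξ).translate x
  · exact (Homeomorph.addLeft x).isOpenMap _ (isOpen_roundCone c r ξ)
  · exact (roundCone_nonempty hc hr hξ).image _
  · have := (Homeomorph.addLeft x).image_closure (roundCone c r ξ)
    change x ∈ closure (Homeomorph.addLeft x '' roundCone c r ξ)
    rw [← this]
    exact ⟨0, zero_mem_closure_roundCone hc hr hξ, by simp⟩

theorem HasInteriorCones.subset_closure_interior {c r : ℝ} {Ω : Set E}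
    (h : HasInteriorCones c r Ω) (hc0 : 0 ≤ c) (hc : c < 1) (hr : 0 < r) :
    Ω ⊆ closure (interior Ω) := by
  intro x hx
  obtain ⟨U, hU, -, hUo, -, hxU⟩ := h.exists_convex hc0 hc hr hx
  exact closure_mono (interior_maximal hU hUo) hxU

theorem HasInteriorCones.uniqueDiffOn {c r : ℝ} {Ω : Set E}
    (h : HasInteriorCones c r Ω) (hc0 : 0 ≤ c) (hc : c < 1) (hr : 0 < r) :
    UniqueDiffOn ℝ Ω := by
  intro x hx
  obtain ⟨U, hU, hUc, hUo, hUn, hxU⟩ := h.exists_convex hc0 hc hr hx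
  exact (uniqueDiffWithinAt_convex hUc (by rwa [hUo.interior_eq]) hxU).mono hU

end Cone

theorem InteriorConeCondition.hasInteriorCones {d : ℕ} {Ω : Set (EuclideanSpace ℝ (Fin d))}
    (h : InteriorConeCondition Ω) :
    ∃ c r : ℝ, 0 ≤ c ∧ c < 1 ∧ 0 < r ∧ HasInteriorCones c r Ω := by
  obtain ⟨θ, r, hθ, hθ', hr, h⟩ := h
  refine ⟨Real.cos θ, r, Real.cos_nonneg_of_mem_Icc ⟨by linarith, by linarith⟩, ?_, hr, ?_⟩
  · rw [← Real.cos_zero]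
    exact Real.cos_lt_cos_of_nonneg_of_le_pi le_rfl (by linarith) hθ
  · intro x hx
    obtain ⟨ξ, hξ, hy⟩ := h x hx
    refine ⟨ξ, hξ, fun y hyc => ?_⟩
    have hy0 : y ≠ 0 := by
      rintro rfl
      simpa using hyc.2
    have hyn : 0 < ‖y‖ := norm_pos_iff.2 hy0
    have := hy (‖y‖⁻¹ • y) ‖y‖ (by rw [norm_smul, norm_inv, norm_norm, inv_mul_cancel₀ hyn.ne'])
      (by
        rw [real_inner_smul_left, inv_mul_eq_div, le_div_iff₀ hyn]
        exact hyc.2.le) hyn.le hyc.1.le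
    rwa [smul_smul, mul_inv_cancel₀ hyn.ne', one_smul] at this

/-! ### The Mercer expansion on the domain -/

theorem isOpenPosMeasure_comap_subtype_val {E : Type*} [TopologicalSpace E] [MeasurableSpace E]
    [BorelSpace E] (ν : Measure E) [ν.IsOpenPosMeasure] {Ω : Set E} (hm : MeasurableSet Ω)
    (hΩ : Ω ⊆ closure (interior Ω)) :
    (ν.comap ((↑) : Ω → E)).IsOpenPosMeasure := by
  refine ⟨fun U hU ⟨x, hx⟩ => ?_⟩
  obtain ⟨V, hV, rfl⟩ := isOpen_induced_iff.1 hU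
  rw [comap_subtype_coe_apply hm, Subtype.image_preimage_coe]
  have hne : (V ∩ interior Ω).Nonempty := mem_closure_iff.1 (hΩ x.2) V hV hx
  refine ne_of_gt (((hV.inter isOpen_interior).measure_pos ν hne).trans_le (measure_mono ?_))
  exact fun y hy => ⟨interior_subset hy.2, hy.1⟩

theorem hasSum_featureMap_mul {d : ℕ} {Ω : Set (EuclideanSpace ℝ (Fin d))}
    (hΩ : IsCompact Ω) (hΩi : Ω ⊆ closure (interior Ω))
    {Φ : EuclideanSpace ℝ (Fin d) → EuclideanSpace ℝ (Fin d) → ℝ}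
    (hΦ : ContinuousOn (Function.uncurry Φ) (Ω ×ˢ Ω))
    {lam : ℕ → ℝ} {e : ℕ → EuclideanSpace ℝ (Fin d) → ℝ} (heig : IsEigenSystem Ω Φ lam e)
    {x y : EuclideanSpace ℝ (Fin d)} (hx : x ∈ Ω) (hy : y ∈ Ω) :
    HasSum (fun k => featureMap lam e k x * featureMap lam e k y) (Φ x y) := by
  have hm : MeasurableSet Ω := hΩ.measurableSet
  set μ : Measure Ω := volume.comap ((↑) : Ω → EuclideanSpace ℝ (Fin d)) with hμ
  have : CompactSpace Ω := isCompact_iff_compactSpace.1 hΩ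
  have : IsFiniteMeasure μ := ⟨by
    rw [hμ, comap_subtype_coe_apply hm, Set.image_univ, Subtype.range_coe]
    exact hΩ.measure_lt_top⟩
  have : μ.IsOpenPosMeasure := isOpenPosMeasure_comap_subtype_val volume hm hΩi
  have hint : ∀ g : EuclideanSpace ℝ (Fin d) → ℝ, ∫ z : Ω, g z ∂μ = ∫ z in Ω, g z :=
    fun g => integral_subtype_comap hm g
  have hΦ' : Continuous fun p : Ω × Ω => Φ p.1 p.2 :=
    hΦ.comp_continuous (f := fun p : Ω × Ω =>
      ((p.1 : EuclideanSpace ℝ (Fin d)), (p.2 : EuclideanSpace ℝ (Fin d))))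
      (by fun_prop) fun p => ⟨p.1.2, p.2.2⟩
  have h : HasSum (fun k => lam k * e k x * e k y) (Φ x y) := hasSum_mercer μ
    ⟨fun p : Ω × Ω => Φ p.1 p.2, hΦ'⟩ lam
    (fun k => ⟨fun z : Ω => e k z, (heig.continuousOn k).domRestrict⟩) heig.pos
    (fun j k => (hint fun z => e j z * e k z).trans (heig.orthonormal j k))
    (fun k z => (hint fun w => Φ z w * e k w).trans (heig.eigen k z z.2))
    (by
      intro g hg z
      -- the extension of `g` by zero outside `Ω`
      set G : EuclideanSpace ℝ (Fin d) → ℝ := Function.extend Subtype.val g 0 with hG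
      have hGg : ∀ w : Ω, G w = g w := fun w => Subtype.val_injective.extend_apply g 0 w
      have hGm : MemLp G 2 (volume.restrict Ω) := by
        rw [← map_comap_subtype_coe hm,
          (MeasurableEmbedding.subtype_coe hm).memLp_map_measure_iff]
        have : G ∘ ((↑) : Ω → EuclideanSpace ℝ (Fin d)) = g := funext hGg
        rw [this]
        exact Lp.memLp g
      have h0 := heig.complete G hGm (fun k => by
        rw [← hint fun w => e k w * G w]
        simp only [hGg]
        exact hg k) z z.2
      rw [← hint fun w => Φ z w * G w] at h0
      simp only [hGg] at h0
      exact h0) ⟨x, hx⟩ ⟨y, hy⟩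
  convert h using 2 with k
  simp only [featureMap]
  rw [mul_mul_mul_comm, Real.mul_self_sqrt (heig.pos k).le, mul_assoc]

/-! ### Kernel values at functionals annihilating polynomials -/

section Taylor

/-- Taylor's formula on `[0, 1]` for a chain of successive derivatives, without the factorial in
the remainder. -/
theorem abs_sub_sum_taylor_le (N : ℕ) : ∀ (F : ℕ → ℝ → ℝ) {K : ℝ},
    (∀ j < N, ∀ t ∈ Set.Icc (0 : ℝ) 1, HasDerivWithinAt (F j) (F (j + 1) t) (Set.Icc 0 1) t) →
    (∀ t ∈ Set.Icc (0 : ℝ) 1, |F N t| ≤ K) →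
    ∀ t ∈ Set.Icc (0 : ℝ) 1,
      |F 0 t - ∑ j ∈ Finset.range N, t ^ j / (j.factorial : ℝ) * F j 0| ≤ K := by
  induction N with
  | zero => intro F K _ hb t ht; simpa using hb t ht
  | succ N ih =>
    intro F K hd hb t ht
    have h1 := ih (fun j => F (j + 1)) (K := K) (fun j hj => hd (j + 1) (by omega)) hb
    set G : ℝ → ℝ := fun t =>
      F 0 t - ∑ j ∈ Finset.range (N + 1), t ^ j / (j.factorial : ℝ) * F j 0 with hG
    have hderiv : ∀ s ∈ Set.Icc (0 : ℝ) 1, HasDerivWithinAt G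
        (F 1 s - ∑ j ∈ Finset.range N, s ^ j / (j.factorial : ℝ) * F (j + 1) 0)
        (Set.Icc 0 1) s := by
      intro s hs
      refine (hd 0 (by omega) s hs).sub ?_
      have : HasDerivAt (fun t : ℝ => ∑ j ∈ Finset.range (N + 1), t ^ j / (j.factorial : ℝ) * F j 0)
          (∑ j ∈ Finset.range (N + 1), (j * s ^ (j - 1)) / (j.factorial : ℝ) * F j 0) s :=
        HasDerivAt.fun_sum fun j _ => ((hasDerivAt_pow j s).div_const _).mul_const _
      convert this.hasDerivWithinAt using 1
      rw [Finset.sum_range_succ']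
      simp only [Nat.cast_zero, zero_mul, zero_div, add_zero]
      refine Finset.sum_congr rfl fun j _ => ?_
      rw [Nat.factorial_succ, Nat.add_sub_cancel]
      have : ((j.factorial : ℕ) : ℝ) ≠ 0 := Nat.cast_ne_zero.2 j.factorial_ne_zero
      push_cast
      field_simp
    have hG0 : G 0 = 0 := by
      simp [hG, Finset.sum_range_succ']
    have := norm_image_sub_le_of_norm_deriv_le_segment' hderiv
      (fun s hs => h1 s ⟨hs.1, hs.2.le⟩) t ht
    rw [hG0, sub_zero, sub_zero, Real.norm_eq_abs] at this
    have hK : 0 ≤ K := (abs_nonneg _).trans (hb t ht)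
    exact this.trans (mul_le_of_le_one_right hK ht.2)

/-- Freezing the arguments outside `s` turns a multilinear form into one of degree `#s`. -/
theorem MultilinearMap.exists_eq_piecewise_const {F : Type*} [AddCommGroup F] [Module ℝ F] {l : ℕ}
    (M : MultilinearMap ℝ (fun _ : Fin l => F) ℝ) (s : Finset (Fin l)) (y : F) :
    ∃ M' : MultilinearMap ℝ (fun _ : Fin s.card => F) ℝ,
      ∀ x, M' (fun _ => x) = M (s.piecewise (fun _ => x) fun _ => y) := by
  let ev : MultilinearMap ℝ (fun _ : Fin sᶜ.card => F) ℝ →ₗ[ℝ] ℝ :=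
    { toFun := fun g => g fun _ => y
      map_add' := fun _ _ => rfl
      map_smul' := fun _ _ => rfl }
  exact ⟨ev.compMultilinearMap (MultilinearMap.curryFinFinset ℝ ℝ F rfl rfl M),
    fun x => MultilinearMap.curryFinFinset_apply_const rfl rfl M x y⟩

variable {E : Type*} [NormedAddCommGroup E] [NormedSpace ℝ E]

/-- The functional `p ↦ ∑ b_i p(u_i)` annihilates all polynomials of degree less than `N`. The
homogeneous polynomials of degree `l` are the diagonals of the `l`-linear forms. -/
def AnnihilatesPolynomials {ι : Type*} [Fintype ι] (N : ℕ) (b : ι → ℝ) (u : ι → E) : Prop :=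
  ∀ l < N, ∀ M : MultilinearMap ℝ (fun _ : Fin l => E) ℝ, ∑ i, b i * M (fun _ => u i) = 0

/-- If a functional annihilates polynomials of degree less than `N`, then its tensor square
annihilates polynomials of degree less than `2 N` on the product space, since every monomial has
degree less than `N` in one of the two variables. -/
theorem AnnihilatesPolynomials.sum_sum_eq_zero {ι : Type*} [Fintype ι] {N : ℕ} {b : ι → ℝ}
    {u : ι → E} (h : AnnihilatesPolynomials N b u) {l : ℕ} (hl : l < 2 * N)
    (M : MultilinearMap ℝ (fun _ : Fin l => E × E) ℝ) :
    ∑ p, ∑ q, b p * b q * M (fun _ => (u p, u q)) = 0 := by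
  classical
  have hexp : ∀ p q, M (fun _ => (u p, u q))
      = ∑ s : Finset (Fin l), M (s.piecewise (fun _ => (u p, 0)) (fun _ => (0, u q))) := by
    intro p q
    rw [← MultilinearMap.map_add_univ]
    congr 1; ext i <;> simp
  have hzero : ∀ s : Finset (Fin l),
      ∑ p, ∑ q, b p * b q * M (s.piecewise (fun _ => (u p, 0)) (fun _ => (0, u q))) = 0 := by
    intro s
    have hcard : s.card + sᶜ.card = l := by simp
    rcases lt_or_ge s.card N with hs | hs
    · rw [Finset.sum_comm]
      refine Finset.sum_eq_zero fun q _ => ?_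
      obtain ⟨M', hM'⟩ := M.exists_eq_piecewise_const s ((0 : E), u q)
      have h1 := h s.card hs (M'.compLinearMap fun _ => LinearMap.inl ℝ E E)
      simp only [MultilinearMap.compLinearMap_apply, LinearMap.inl_apply, hM'] at h1
      simp only [mul_right_comm _ (b q), ← Finset.sum_mul]
      rw [h1, zero_mul]
    · refine Finset.sum_eq_zero fun p _ => ?_
      obtain ⟨M', hM'⟩ := M.exists_eq_piecewise_const sᶜ (u p, (0 : E))
      have h1 := h sᶜ.card (by omega) (M'.compLinearMap fun _ => LinearMap.inr ℝ E E)
      simp only [MultilinearMap.compLinearMap_apply, LinearMap.inr_apply, hM',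
        Finset.piecewise_compl] at h1
      simp only [mul_assoc, ← Finset.mul_sum]
      rw [h1, mul_zero]
  simp only [hexp, Finset.mul_sum]
  have hswap : ∀ p, ∑ q, ∑ s : Finset (Fin l),
      b p * b q * M (s.piecewise (fun _ => (u p, 0)) (fun _ => (0, u q)))
      = ∑ s : Finset (Fin l), ∑ q,
        b p * b q * M (s.piecewise (fun _ => (u p, 0)) (fun _ => (0, u q))) :=
    fun p => Finset.sum_comm
  simp only [hswap]
  rw [Finset.sum_comm]
  exact Finset.sum_eq_zero fun s _ => hzero s

/-- Bound for the tensor square of an annihilating functional applied to a kernel of class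
`C^{2γ}`: only the Taylor remainder of order `2γ` contributes. -/
theorem exists_kernel_sum_le_of_annihilates {Ω : Set E} (hΩ : IsCompact Ω)
    (hu : UniqueDiffOn ℝ Ω) {Φ : E → E → ℝ} {γ : ℕ}
    (hΦ : ContDiffOn ℝ ((2 * γ : ℕ) : WithTop ℕ∞) (Function.uncurry Φ) (Ω ×ˢ Ω)) :
    ∃ K : ℝ, 0 ≤ K ∧ ∀ (ι : Type) [Fintype ι] (b : ι → ℝ) (u : ι → E) (x : E) (ρ : ℝ),
      AnnihilatesPolynomials γ b u → (∀ p, ‖u p‖ ≤ ρ) →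
      (∀ p, ∀ t ∈ Set.Icc (0 : ℝ) 1, x + t • u p ∈ Ω) →
      ∑ p, ∑ q, b p * b q * Φ (x + u p) (x + u q) ≤ K * ρ ^ (2 * γ) * (∑ p, |b p|) ^ 2 := by
  have hu2 : UniqueDiffOn ℝ (Ω ×ˢ Ω) := hu.prod hu
  have hT := hΦ.ftaylorSeriesWithin hu2
  set P := ftaylorSeriesWithin ℝ (Function.uncurry Φ) (Ω ×ˢ Ω) with hP
  obtain ⟨K, hK⟩ := (hΩ.prod hΩ).exists_bound_of_continuousOn (hT.cont (2 * γ) le_rfl)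
  refine ⟨max K 0, le_max_right _ _, fun ι _ b u x ρ hb hρ hseg => ?_⟩
  have hrem : ∀ p q, |Φ (x + u p) (x + u q) - ∑ j ∈ Finset.range (2 * γ),
      1 / (j.factorial : ℝ) * P (x, x) j (fun _ => (u p, u q))| ≤ max K 0 * ρ ^ (2 * γ) := by
    intro p q
    set L : ℝ → E × E := fun t => (x + t • u p, x + t • u q) with hL
    have hLΩ : ∀ t ∈ Set.Icc (0 : ℝ) 1, L t ∈ Ω ×ˢ Ω := fun t ht => ⟨hseg p t ht, hseg q t ht⟩
    have hLd : ∀ t, HasDerivAt L (u p, u q) t := by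
      intro t
      refine HasDerivAt.prodMk ?_ ?_
      · simpa using ((hasDerivAt_id t).smul_const (u p)).const_add x
      · simpa using ((hasDerivAt_id t).smul_const (u q)).const_add x
    have hder : ∀ j < 2 * γ, ∀ t ∈ Set.Icc (0 : ℝ) 1,
        HasDerivWithinAt (fun t => P (L t) j (fun _ => (u p, u q)))
          (P (L t) (j + 1) (fun _ => (u p, u q))) (Set.Icc 0 1) t := by
      intro j hj t ht
      have h1 := hT.fderivWithin j (by exact_mod_cast hj) (L t) (hLΩ t ht)
      have h2 := h1.comp_hasDerivWithinAt t (hLd t).hasDerivWithinAt hLΩ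
      have h3 := ((ContinuousMultilinearMap.apply ℝ (fun _ : Fin j => E × E) ℝ
        (fun _ => (u p, u q))).hasFDerivAt).comp_hasDerivWithinAt t h2
      refine h3.congr_deriv ?_
      simp only [ContinuousMultilinearMap.apply_apply, ContinuousMultilinearMap.curryLeft_apply]
      congr 1; ext i <;> refine Fin.cases ?_ (fun i => ?_) i <;> simp
    have hρ0 : 0 ≤ ρ := (norm_nonneg _).trans (hρ p)
    have hbd : ∀ t ∈ Set.Icc (0 : ℝ) 1,
        |P (L t) (2 * γ) (fun _ => (u p, u q))| ≤ max K 0 * ρ ^ (2 * γ) := by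
      intro t ht
      have h1 := (P (L t) (2 * γ)).le_opNorm (fun _ => (u p, u q))
      rw [Finset.prod_const, Finset.card_univ, Fintype.card_fin, Real.norm_eq_abs] at h1
      refine h1.trans ?_
      gcongr
      · exact (hK _ (hLΩ t ht)).trans (le_max_left _ _)
      · exact max_le (hρ p) (hρ q)
    have h := abs_sub_sum_taylor_le (2 * γ) (fun j t => P (L t) j (fun _ => (u p, u q))) hder hbd
      1 ⟨zero_le_one, le_rfl⟩
    have e1 : P (L 1) 0 (fun _ => (u p, u q)) = Φ (x + u p) (x + u q) := by
      rw [hT.zero_eq' (hLΩ 1 ⟨zero_le_one, le_rfl⟩)]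
      simp [hL]
    have e2 : L 0 = (x, x) := by simp [hL]
    rw [e1] at h
    simpa only [one_pow, e2] using h
  have hpoly : ∑ p, ∑ q, b p * b q * ∑ j ∈ Finset.range (2 * γ),
      1 / (j.factorial : ℝ) * P (x, x) j (fun _ => (u p, u q)) = 0 := by
    simp only [Finset.mul_sum]
    have : ∀ p, ∑ q, ∑ j ∈ Finset.range (2 * γ),
        b p * b q * (1 / (j.factorial : ℝ) * P (x, x) j (fun _ => (u p, u q)))
        = ∑ j ∈ Finset.range (2 * γ), ∑ q,
          b p * b q * (1 / (j.factorial : ℝ) * P (x, x) j (fun _ => (u p, u q))) :=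
      fun p => Finset.sum_comm
    simp only [this]
    rw [Finset.sum_comm]
    refine Finset.sum_eq_zero fun j hj => ?_
    have h1 := hb.sum_sum_eq_zero (Finset.mem_range.1 hj) (P (x, x) j).toMultilinearMap
    simp only [mul_left_comm _ (1 / (j.factorial : ℝ)) _, ← Finset.mul_sum]
    exact mul_eq_zero_of_right _ h1
  refine (sub_zero (∑ p, ∑ q, b p * b q * Φ (x + u p) (x + u q))).symm.le.trans ?_
  nth_rewrite 1 [← hpoly]
  simp only [← Finset.sum_sub_distrib, ← mul_sub]
  rw [sq, Finset.sum_mul_sum, Finset.mul_sum]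
  refine Finset.sum_le_sum fun p _ => ?_
  rw [Finset.mul_sum]
  refine Finset.sum_le_sum fun q _ => ?_
  refine (le_abs_self _).trans ?_
  rw [abs_mul, abs_mul, mul_comm]
  gcongr
  exact hrem p q

end Taylor

/-! ### Stable polynomial reproduction at scattered points -/

section Nodes

variable {E : Type*} [NormedAddCommGroup E] [NormedSpace ℝ E]

/-- The vector of all monomials of degree less than `N`, in coordinates with respect to a basis. -/
noncomputable def monomialVector {κ : Type} (B : Module.Basis κ ℝ E) (N : ℕ) (u : E) :
    (Σ l : Fin N, (Fin l → κ)) → ℝ :=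
  fun s => ∏ i, B.repr u (s.2 i)

theorem continuous_monomialVector [FiniteDimensional ℝ E] {κ : Type}
    (B : Module.Basis κ ℝ E) (N : ℕ) : Continuous (monomialVector B N) := by
  refine continuous_pi fun s => continuous_finsetProd _ fun i _ => ?_
  exact (B.coord (s.2 i)).continuous_of_finiteDimensional

theorem MultilinearMap.apply_const_eq_sum_monomialVector {κ : Type} [Fintype κ]
    (B : Module.Basis κ ℝ E) {N l : ℕ} (hl : l < N)
    (M : MultilinearMap ℝ (fun _ : Fin l => E) ℝ) (u : E) :
    M (fun _ => u) = ∑ s : Fin l → κ, monomialVector B N u ⟨⟨l, hl⟩, s⟩ * M (fun i => B (s i)) := by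
  classical
  conv_lhs => rw [← B.sum_repr u]
  rw [M.map_sum (fun (_ : Fin l) k => B.repr u k • B k)]
  refine Finset.sum_congr rfl fun s _ => ?_
  rw [M.map_smul_univ (fun i => B.repr u (s i)) fun i => B (s i)]
  rfl

/-- For a point `z` of the closure of an open set `U` there are finitely many nodes in `U` such
that, at every sufficiently small perturbation of the nodes, evaluation of polynomials of degree
less than `N` at `z` is a combination of the node evaluations with uniformly bounded weights.
The nodes are chosen so that their monomial vectors form a basis of the span `S` of all monomial
vectors of `U`; as `S` is closed, it contains the monomial vector of `z`. -/
theorem exists_stable_nodes [FiniteDimensional ℝ E] {U : Set E} (hU : IsOpen U) {z : E}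
    (hz : z ∈ closure U) (N : ℕ) :
    ∃ (ι : Type) (_ : Fintype ι) (y : ι → E) (ε A : ℝ), 0 < ε ∧ 0 ≤ A ∧ (∀ q, y q ∈ U) ∧
      ∀ y' : ι → E, (∀ q, ‖y' q - y q‖ < ε) → (∀ q, y' q ∈ U) ∧
        ∃ a : ι → ℝ, ∑ q, |a q| ≤ A ∧ ∀ l < N, ∀ M : MultilinearMap ℝ (fun _ : Fin l => E) ℝ,
          ∑ q, a q * M (fun _ => y' q) = M (fun _ => z) := by
  classical
  set B := Module.finBasis ℝ E with hB
  set Ψ := monomialVector B N with hΨ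
  have hΨc : Continuous Ψ := continuous_monomialVector B N
  obtain ⟨b, hbU, hbspan, hbli⟩ := exists_linearIndependent ℝ (Ψ '' U)
  have hbfin : b.Finite := hbli.setFinite
  have : Fintype b := hbfin.fintype
  choose y hyU hyΨ using fun q : b => hbU q.2
  set S := Submodule.span ℝ (Set.range (Subtype.val : b → _)) with hS
  have hSU : ∀ u ∈ U, Ψ u ∈ S := by
    intro u hu
    rw [hS, Subtype.range_coe, hbspan]
    exact Submodule.subset_span ⟨u, hu, rfl⟩
  have hSz : Ψ z ∈ S := by
    have h1 : z ∈ closure (Ψ ⁻¹' (S : Set _)) := closure_mono hSU hz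
    have h2 : IsClosed (Ψ ⁻¹' (S : Set _)) := S.closed_of_finiteDimensional.preimage hΨc
    rwa [h2.closure_eq] at h1
  let bas := Module.Basis.span hbli
  obtain ⟨c, hc⟩ := LinearMap.exists_extend (bas.equivFun : S →ₗ[ℝ] (b → ℝ))
  have hcS : ∀ (w) (hw : w ∈ S), c w = bas.equivFun ⟨w, hw⟩ := fun w hw =>
    LinearMap.congr_fun hc ⟨w, hw⟩
  have hc0 : ∀ w ∈ S, c w = 0 → w = 0 := by
    intro w hw h0
    rw [hcS w hw, LinearEquiv.map_eq_zero_iff] at h0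
    exact congrArg Subtype.val h0
  have hcc : Continuous c := c.continuous_of_finiteDimensional
  -- coordinates of the monomial vectors of the nodes
  let G : (b → E) → Matrix b b ℝ := fun y' => Matrix.of fun p q => c (Ψ (y' q)) p
  have hGc : Continuous G := by
    refine continuous_matrix fun p q => ?_
    exact (continuous_apply p).comp (hcc.comp (hΨc.comp (continuous_apply q)))
  have hGy : G y = 1 := by
    ext p q
    have hmem : q.1 ∈ S := Submodule.subset_span ⟨q, rfl⟩
    have : (⟨q.1, hmem⟩ : S) = bas q := (Module.Basis.span_apply hbli q).symm
    simp only [G, Matrix.of_apply, hyΨ]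
    rw [hcS _ hmem, this, Module.Basis.equivFun_self, Matrix.one_apply]
    simp [eq_comm]
  let a : (b → E) → b → ℝ := fun y' => (G y')⁻¹.mulVec (c (Ψ z))
  have hdet : (G y).det ≠ 0 := by rw [hGy]; simp
  have hac : ContinuousAt (fun y' => ∑ q, |a y' q|) y := by
    have h1 : ContinuousAt (fun y' => (G y')⁻¹) y := by
      simp only [Matrix.inv_def, Ring.inverse_eq_inv']
      exact (hGc.matrix_det.continuousAt.inv₀ hdet).smul hGc.matrix_adjugate.continuousAt
    have h2 : Continuous fun H : Matrix b b ℝ => ∑ q, |H.mulVec (c (Ψ z)) q| := by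
      refine continuous_finsetSum _ fun q _ => Continuous.abs ?_
      exact (continuous_apply q).comp (continuous_id.matrix_mulVec continuous_const)
    exact h2.continuousAt.comp h1
  set A := ∑ q, |a y q| + 1 with hA
  have hev : ∀ᶠ y' in nhds y, (G y').det ≠ 0 ∧ ∑ q, |a y' q| < A ∧ ∀ q, y' q ∈ U := by
    refine (hGc.matrix_det.continuousAt.eventually_ne hdet).and
      ((hac.eventually_lt continuousAt_const (by simp [hA])).and ?_)
    rw [Filter.eventually_all]
    exact fun q => (continuous_apply q).continuousAt.eventually_mem (hU.mem_nhds (hyU q))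
  obtain ⟨ε, hε, hball⟩ := Metric.eventually_nhds_iff.1 hev
  refine ⟨b, inferInstance, y, ε, A, hε, by positivity, hyU, fun y' hy' => ?_⟩
  obtain ⟨hd, hsum, hmem⟩ := hball ((dist_pi_lt_iff hε).2 fun q => by
    rw [dist_eq_norm]; exact hy' q)
  refine ⟨hmem, a y', hsum.le, fun l hl M => ?_⟩
  have hvec : ∑ q, a y' q • Ψ (y' q) = Ψ z := by
    rw [← sub_eq_zero]
    refine hc0 _ (S.sub_mem (S.sum_mem fun q _ => S.smul_mem _ (hSU _ (hmem q))) hSz) ?_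
    rw [map_sub, map_sum, sub_eq_zero]
    have h1 : (G y').mulVec (a y') = c (Ψ z) := by
      simp only [a]
      rw [Matrix.mulVec_mulVec, Matrix.mul_nonsing_inv _ (isUnit_iff_ne_zero.2 hd),
        Matrix.one_mulVec]
    rw [← h1]
    ext p
    simp [Matrix.mulVec, dotProduct, G, mul_comm]
  simp only [M.apply_const_eq_sum_monomialVector B hl]
  simp only [Finset.mul_sum]
  rw [Finset.sum_comm]
  refine Finset.sum_congr rfl fun s _ => ?_
  simp only [← mul_assoc, ← Finset.sum_mul]
  congr 1
  have := congrFun hvec ⟨⟨l, hl⟩, s⟩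
  rw [Finset.sum_apply] at this
  exact this

end Nodes

section Sampling

variable {E : Type*} [NormedAddCommGroup E] [InnerProductSpace ℝ E] [FiniteDimensional ℝ E]

/-- Local polynomial reproduction on a set with interior cones: evaluation at `x` of polynomials of
degree less than `N` is a combination, with uniformly bounded weights, of evaluations at data points
within distance proportional to `h`. The nodes of a reference cone are rotated to the
cone at `x`, scaled by a multiple of `h`, and replaced by nearby data points. -/
theorem exists_local_polynomial_reproduction {Ω : Set E} {c r : ℝ}
    (hc : c < 1) (hr : 0 < r) (hΩ : HasInteriorCones c r Ω) (N : ℕ) :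
    ∃ h₀ R₀ A : ℝ, 0 < h₀ ∧ 0 ≤ R₀ ∧ 0 ≤ A ∧ ∀ (h : ℝ), 0 < h → h ≤ h₀ →
      ∀ (n : ℕ) (X : Fin n → E), (∀ z ∈ Ω, ∃ i, ‖z - X i‖ ≤ h) → ∀ x ∈ Ω,
      ∃ (ι : Type) (_ : Fintype ι) (idx : ι → Fin n) (a : ι → ℝ), ∑ q, |a q| ≤ A ∧
        (∀ q, ‖X (idx q) - x‖ ≤ R₀ * h) ∧
        (∀ q, ∀ t ∈ Set.Icc (0 : ℝ) 1, x + t • (X (idx q) - x) ∈ Ω) ∧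
        ∀ l < N, ∀ M : MultilinearMap ℝ (fun _ : Fin l => E) ℝ,
          ∑ q, a q * M (fun _ => X (idx q) - x) = M (fun _ => 0) := by
  rcases Ω.eq_empty_or_nonempty with rfl | ⟨x₀, hx₀⟩
  · exact ⟨1, 0, 0, one_pos, le_rfl, le_rfl, fun _ _ _ _ _ _ x hx => hx.elim⟩
  obtain ⟨ξ₀, hξ₀, -⟩ := hΩ x₀ hx₀
  obtain ⟨ι, hι, y, ε, A, hε, hA, hy, hnodes⟩ := exists_stable_nodes
    (isOpen_roundCone c 1 ξ₀) (zero_mem_closure_roundCone hc one_pos hξ₀) N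
  refine ⟨ε * r / 2, 2 / ε, A, by positivity, by positivity, hA,
    fun h hh hh0 n X hX x hx => ?_⟩
  obtain ⟨ξ, hξ, hcone⟩ := hΩ x hx
  obtain ⟨O, hO⟩ : ∃ O : E ≃ₗᵢ[ℝ] E, O ξ₀ = ξ :=
    ⟨_, Submodule.reflection_sub (hξ₀.trans hξ.symm)⟩
  set R := 2 * h / ε with hR
  have hR0 : 0 < R := by positivity
  have hRr : R ≤ r := by
    rw [hR, div_le_iff₀ hε]; linarith
  have hmem : ∀ w ∈ roundCone c 1 ξ₀, ∀ t ∈ Set.Icc (0 : ℝ) 1, x + t • (R • O w) ∈ Ω := by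
    intro w hw t ht
    rcases ht.1.eq_or_lt with rfl | ht0
    · simpa using hx
    · refine hcone _ ?_
      rw [smul_smul]
      have htR : 0 < t * R := by positivity
      have h1 := smul_mem_roundCone htR (O.map_mem_roundCone hw)
      rw [hO] at h1
      refine roundCone_mono ?_ ξ h1
      rw [mul_one]
      exact (mul_le_of_le_one_left hR0.le ht.2).trans hRr
  choose idx hidx using fun q => hX (x + R • O (y q))
    (by simpa using hmem (y q) (hy q) 1 ⟨zero_le_one, le_rfl⟩)
  -- the chosen data points in the coordinates of the reference cone are within `ε / 2` of the nodes
  set y' : ι → E := fun q => O.symm (R⁻¹ • (X (idx q) - x)) with hy'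
  have hXy' : ∀ q, X (idx q) - x = R • O (y' q) := by
    intro q
    simp [hy', smul_smul, mul_inv_cancel₀ hR0.ne']
  obtain ⟨hyU, a, ha, hpoly⟩ := hnodes y' (by
    intro q
    have h1 : R * ‖y' q - y q‖ = ‖x + R • O (y q) - X (idx q)‖ := by
      rw [← O.norm_map, map_sub, ← Real.norm_of_nonneg hR0.le, ← norm_smul, smul_sub,
        Real.norm_of_nonneg hR0.le, ← hXy', ← norm_neg]
      congr 1; abel
    have h2 : R * ‖y' q - y q‖ < R * ε := by
      rw [h1]
      refine (hidx q).trans_lt ?_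
      rw [hR, div_mul_cancel₀ _ hε.ne']; linarith
    exact lt_of_mul_lt_mul_left h2 hR0.le)
  refine ⟨ι, hι, idx, a, ha, fun q => ?_, fun q t ht => ?_, fun l hl M => ?_⟩
  · rw [hXy', norm_smul, O.norm_map, Real.norm_of_nonneg hR0.le]
    calc R * ‖y' q‖ ≤ R * 1 := by gcongr; exact (hyU q).1.le
      _ = 2 / ε * h := by rw [hR]; ring
  · rw [hXy']; exact hmem _ (hyU q) t ht
  · have := hpoly l hl (M.compLinearMap fun _ => R • (O.toLinearEquiv : E →ₗ[ℝ] E))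
    simpa [hXy'] using this

end Sampling

theorem hasSum_sq_sum {E ι : Type*} [Fintype ι] {φ : ℕ → E → ℝ} {Φ : E → E → ℝ} (x : ι → E)
    (b : ι → ℝ) (hΦ : ∀ p q, HasSum (fun k => φ k (x p) * φ k (x q)) (Φ (x p) (x q))) :
    HasSum (fun k => (∑ p, b p * φ k (x p)) ^ 2)
      (∑ p, ∑ q, b p * b q * Φ (x p) (x q)) := by
  have e : (fun k => (∑ p, b p * φ k (x p)) ^ 2)
      = fun k => ∑ p, ∑ q, b p * b q * (φ k (x p) * φ k (x q)) := by
    ext k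
    rw [sq, Finset.sum_mul_sum]
    exact Finset.sum_congr rfl fun p _ => Finset.sum_congr rfl fun q _ => by ring
  rw [e]
  exact hasSum_sum fun p _ => hasSum_sum fun q _ => (hΦ p q).mul_left (b p * b q)

/-- Cauchy–Schwarz inequality for a finite combination of point evaluations on functions with
square summable coefficients. -/
theorem sq_sum_le_of_hasSum {E ι : Type*} [Fintype ι] {φ : ℕ → E → ℝ} {Φ : E → E → ℝ}
    {δ : ℕ → ℝ} {D : ℝ} (hδ : ∀ s : Finset ℕ, ∑ k ∈ s, δ k ^ 2 ≤ D) {g : E → ℝ} (x : ι → E)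
    (b : ι → ℝ) (hΦ : ∀ p q, HasSum (fun k => φ k (x p) * φ k (x q)) (Φ (x p) (x q)))
    (hg : ∀ p, HasSum (fun k => δ k * φ k (x p)) (g (x p))) :
    (∑ p, b p * g (x p)) ^ 2 ≤ D * ∑ p, ∑ q, b p * b q * Φ (x p) (x q) := by
  have h1 : HasSum (fun k => δ k * ∑ p, b p * φ k (x p)) (∑ p, b p * g (x p)) := by
    have e : (fun k => δ k * ∑ p, b p * φ k (x p)) = fun k => ∑ p, b p * (δ k * φ k (x p)) := by
      ext k
      rw [Finset.mul_sum]
      exact Finset.sum_congr rfl fun p _ => by ring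
    rw [e]
    exact hasSum_sum fun p _ => (hg p).mul_left (b p)
  have h2 := hasSum_sq_sum x b hΦ
  have hD : 0 ≤ D := by simpa using hδ ∅
  have h3 : Filter.Tendsto (fun s : Finset ℕ => (∑ k ∈ s, δ k * ∑ p, b p * φ k (x p)) ^ 2)
      Filter.atTop (nhds ((∑ p, b p * g (x p)) ^ 2)) := Filter.Tendsto.pow h1 2
  refine le_of_tendsto h3 (Filter.Eventually.of_forall fun s => ?_)
  refine (Finset.sum_mul_sq_le_sq_mul_sq s δ _).trans ?_
  gcongr
  · exact hδ s
  · exact sum_le_hasSum s (fun k _ => sq_nonneg _) h2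

section FillDistance

variable {d : ℕ} {Ω : Set (EuclideanSpace ℝ (Fin d))} {n : ℕ}
  (X : Fin n → EuclideanSpace ℝ (Fin d))

theorem fillDistance_nonneg : 0 ≤ fillDistance Ω X :=
  Real.iSup_nonneg fun _ => Real.iInf_nonneg fun _ => norm_nonneg _

theorem exists_norm_sub_le_fillDistance (hΩ : IsCompact Ω) (hn : 0 < n)
    {z : EuclideanSpace ℝ (Fin d)} (hz : z ∈ Ω) : ∃ i, ‖z - X i‖ ≤ fillDistance Ω X := by
  have : Nonempty (Fin n) := ⟨⟨0, hn⟩⟩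
  obtain ⟨i, hi⟩ := exists_eq_ciInf_of_finite (f := fun i => ‖z - X i‖)
  refine ⟨i, ?_⟩
  rw [hi]
  obtain ⟨M, hM⟩ := hΩ.isBounded.exists_norm_le
  refine le_ciSup (f := fun x : Ω => ⨅ i, ‖(x : EuclideanSpace ℝ (Fin d)) - X i‖)
    ⟨M + ‖X ⟨0, hn⟩‖, ?_⟩ ⟨z, hz⟩
  rintro _ ⟨x, rfl⟩
  refine (ciInf_le ⟨0, ?_⟩ (⟨0, hn⟩ : Fin n)).trans ((norm_sub_le _ _).trans ?_)
  · rintro _ ⟨j, rfl⟩; exact norm_nonneg _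
  · gcongr; exact hM x x.2

end FillDistance

/-- Sampling inequality: a function with square summable coefficients of bounded norm that vanishes
at the data points is of order `h ^ γ`. -/
theorem exists_sampling_bound {d : ℕ} {Ω : Set (EuclideanSpace ℝ (Fin d))}
    (hΩ : IsCompact Ω) {c r : ℝ} (hc0 : 0 ≤ c) (hc : c < 1) (hr : 0 < r)
    (hcone : HasInteriorCones c r Ω)
    {Φ : EuclideanSpace ℝ (Fin d) → EuclideanSpace ℝ (Fin d) → ℝ} {γ : ℕ}
    (hΦ : ContDiffOn ℝ ((2 * γ : ℕ) : WithTop ℕ∞) (Function.uncurry Φ) (Ω ×ˢ Ω))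
    {φ : ℕ → EuclideanSpace ℝ (Fin d) → ℝ}
    (hφ : ∀ x ∈ Ω, ∀ y ∈ Ω, HasSum (fun k => φ k x * φ k y) (Φ x y)) (D : ℝ) :
    ∃ C : ℝ, 0 < C ∧ ∀ (n : ℕ), 0 < n → ∀ X : Fin n → EuclideanSpace ℝ (Fin d), (∀ i, X i ∈ Ω) →
      ∀ δ : ℕ → ℝ, (∀ s : Finset ℕ, ∑ k ∈ s, δ k ^ 2 ≤ D) →
      ∀ g : EuclideanSpace ℝ (Fin d) → ℝ, (∀ x ∈ Ω, HasSum (fun k => δ k * φ k x) (g x)) →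
      (∀ i, g (X i) = 0) → ∀ x ∈ Ω, |g x| ≤ C * fillDistance Ω X ^ γ := by
  obtain ⟨K, hK0, hK⟩ := exists_kernel_sum_le_of_annihilates hΩ
    (hcone.uniqueDiffOn hc0 hc hr) hΦ
  obtain ⟨h₀, R₀, A, hh₀, hR₀, hA, hrep⟩ :=
    exists_local_polynomial_reproduction hc hr hcone γ
  obtain ⟨M, hM⟩ := (hΩ.prod hΩ).exists_bound_of_continuousOn hΦ.continuousOn
  set C₁ := √(|D| * |M|) / h₀ ^ γ with hC₁
  set C₂ := √(|D| * K) * R₀ ^ γ * (1 + A) with hC₂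
  have hC₁0 : 0 ≤ C₁ := by positivity
  have hC₂0 : 0 ≤ C₂ := by positivity
  refine ⟨C₁ + C₂ + 1, by positivity, fun n hn X hX δ hδ g hg hgX x hx => ?_⟩
  set h := fillDistance Ω X with hh
  have hh0 : 0 ≤ h := fillDistance_nonneg X
  have hD : 0 ≤ D := by simpa using hδ ∅
  rw [abs_of_nonneg hD] at hC₁ hC₂
  have hfill : ∀ z ∈ Ω, ∃ i, ‖z - X i‖ ≤ h := fun z hz =>
    exists_norm_sub_le_fillDistance X hΩ hn hz
  -- for `h = 0` every point of `Ω` is a data point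
  rcases hh0.eq_or_lt with hzero | hpos
  · obtain ⟨i, hi⟩ := hfill x hx
    rw [← hzero, norm_le_zero_iff, sub_eq_zero] at hi
    rw [hi, hgX, abs_zero]
    positivity
  -- for large `h` the crude bound `|g x|² ≤ D Φ(x, x)` suffices
  rcases lt_or_ge h₀ h with hlarge | hsmall
  · have h1 := sq_sum_le_of_hasSum (ι := Unit) hδ (fun _ => x) (fun _ => 1)
      (fun _ _ => hφ x hx x hx) (fun _ => hg x hx)
    simp only [Finset.univ_unique, Finset.sum_const, Finset.card_singleton, one_smul,
      one_mul] at h1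
    have h2 : Φ x x ≤ |M| := ((le_abs_self _).trans (hM (x, x) ⟨hx, hx⟩)).trans (le_abs_self _)
    have h3 : |g x| ≤ √(D * |M|) := by
      refine Real.abs_le_sqrt (h1.trans ?_)
      gcongr
    calc |g x| ≤ √(D * |M|) := h3
      _ = C₁ * h₀ ^ γ := by rw [hC₁]; field_simp
      _ ≤ (C₁ + C₂ + 1) * h ^ γ := by
        gcongr
        linarith
  · obtain ⟨ι, hι, idx, a, ha, hnorm, hseg, hpoly⟩ := hrep h hpos hsmall n X hfill x hx
    -- the functional `g ↦ g x - ∑ a_q g (X (idx q))`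
    set b : Option ι → ℝ := fun p => p.elim 1 fun q => -a q with hb
    set u : Option ι → EuclideanSpace ℝ (Fin d) := fun p => p.elim 0 fun q => X (idx q) - x with hu
    have hbsum : ∑ p, |b p| ≤ 1 + A := by
      simp only [Fintype.sum_option, hb, Option.elim, abs_one, abs_neg]
      gcongr
    have hann : AnnihilatesPolynomials γ b u := by
      intro l hl M
      have h1 := hpoly l hl M
      simp only [Fintype.sum_option, hb, hu, Option.elim, one_mul, neg_mul, Finset.sum_neg_distrib]
      rw [h1, add_neg_cancel]
    have hxu : ∀ p, x + u p ∈ Ω := by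
      rintro (_ | q)
      · simpa [hu] using hx
      · simpa [hu] using hX (idx q)
    have h1 := hK (Option ι) b u x (R₀ * h) hann (by
      rintro (_ | q)
      · simp only [hu, Option.elim, norm_zero]; positivity
      · exact hnorm q) (by
      rintro (_ | q) t ht
      · simpa [hu] using hx
      · exact hseg q t ht)
    have h2 := sq_sum_le_of_hasSum hδ (fun p => x + u p) b
      (fun p q => hφ _ (hxu p) _ (hxu q)) (fun p => hg _ (hxu p))
    have h3 : ∑ p, b p * g (x + u p) = g x := by
      simp [Fintype.sum_option, hb, hu, hgX]
    rw [h3] at h2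
    have h4 : |g x| ≤ C₂ * h ^ γ := by
      refine abs_le_of_sq_le_sq ?_ (by positivity)
      calc g x ^ 2 ≤ D * (K * (R₀ * h) ^ (2 * γ) * (∑ p, |b p|) ^ 2) :=
            h2.trans (mul_le_mul_of_nonneg_left h1 hD)
        _ ≤ D * (K * (R₀ * h) ^ (2 * γ) * (1 + A) ^ 2) := by gcongr
        _ = (D * K) * (R₀ ^ γ * (1 + A) * h ^ γ) ^ 2 := by
            rw [mul_pow R₀ h, pow_mul', pow_mul']; ring
        _ = (C₂ * h ^ γ) ^ 2 := by
            rw [hC₂, mul_assoc (√(D * K)), mul_assoc (√(D * K)), mul_pow (√(D * K)),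
              Real.sq_sqrt (by positivity)]
    refine h4.trans ?_
    gcongr
    linarith

/-! ### The multi-linear system -/

theorem abs_le_tsum_abs {v : ℕ → ℝ} (hv : Summable fun k => |v k|) (k : ℕ) :
    |v k| ≤ ∑' k, |v k| :=
  hv.le_tsum k fun _ _ => abs_nonneg _

theorem summable_mul_prod {ι : Type*} (s : Finset ι) {w : ℕ → ℝ} {v : ι → ℕ → ℝ}
    (hw : Summable fun k => |w k|) (hv : ∀ l, Summable fun k => |v l k|) :
    Summable fun k => w k * ∏ l ∈ s, v l k := by
  refine Summable.of_norm_bounded (hw.mul_right (∏ l ∈ s, ∑' k, |v l k|)) fun k => ?_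
  rw [Real.norm_eq_abs, abs_mul, Finset.abs_prod]
  gcongr with l
  exact abs_le_tsum_abs (hv l) k

theorem summable_mul_pow {w u : ℕ → ℝ} (hw : Summable fun k => |w k|)
    (hu : Summable fun k => |u k|) (r : ℕ) : Summable fun k => w k * u k ^ r := by
  simpa using summable_mul_prod (Finset.univ : Finset (Fin r)) hw (fun _ => hu)

theorem summable_abs_sum_mul {n : ℕ} {v : Fin n → ℕ → ℝ} (hv : ∀ j, Summable fun k => |v j k|)
    (c : Fin n → ℝ) : Summable fun k => |∑ j, c j * v j k| := by
  have h : Summable fun k => ∑ j, |c j| * |v j k| :=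
    summable_sum fun j _ => (hv j).mul_left _
  refine Summable.of_nonneg_of_le (fun _ => abs_nonneg _) (fun k => ?_) h
  refine (Finset.abs_sum_le_sum_abs _ _).trans (le_of_eq ?_)
  exact Finset.sum_congr rfl fun j _ => abs_mul _ _

/-- Expansion of a power of a linear combination into its tensor of coefficients. -/
theorem hasSum_mul_sum_pow {n r : ℕ} {w : ℕ → ℝ} {v : Fin n → ℕ → ℝ}
    (hw : Summable fun k => |w k|) (hv : ∀ j, Summable fun k => |v j k|) (c : Fin n → ℝ) :
    HasSum (fun k => w k * (∑ j, c j * v j k) ^ r)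
      (∑ J : Fin r → Fin n, (∑' k, w k * ∏ l, v (J l) k) * ∏ l, c (J l)) := by
  have e : (fun k => w k * (∑ j, c j * v j k) ^ r)
      = fun k => ∑ J : Fin r → Fin n, (w k * ∏ l, v (J l) k) * ∏ l, c (J l) := by
    ext k
    rw [Fintype.sum_pow, Finset.mul_sum]
    refine Finset.sum_congr rfl fun J _ => ?_
    rw [Finset.prod_mul_distrib]; ring
  rw [e]
  exact hasSum_sum fun J _ => (summable_mul_prod _ hw fun l => hv (J l)).hasSum.mul_right _

section Solve

variable {n : ℕ} {v : Fin n → ℕ → ℝ}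

theorem continuous_tsum_mul_sum_pow (hv : ∀ j, Summable fun k => |v j k|) {w : ℕ → ℝ}
    (hw : Summable fun k => |w k|) (r : ℕ) :
    Continuous fun c : Fin n → ℝ => ∑' k, w k * (∑ j, c j * v j k) ^ r := by
  simp only [(hasSum_mul_sum_pow hw hv _).tsum_eq]
  fun_prop

theorem hasSum_pow_succ (hv : ∀ j, Summable fun k => |v j k|) (r : ℕ) (c : Fin n → ℝ) :
    HasSum (fun k => (∑ j, c j * v j k) ^ (r + 1))
      (∑ i, c i * ∑' k, v i k * (∑ j, c j * v j k) ^ r) := by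
  have e : (fun k => (∑ j, c j * v j k) ^ (r + 1))
      = fun k => ∑ i, c i * (v i k * (∑ j, c j * v j k) ^ r) := by
    ext k
    rw [pow_succ', Finset.sum_mul]
    exact Finset.sum_congr rfl fun i _ => mul_assoc _ _ _
  rw [e]
  exact hasSum_sum fun i _ =>
    (summable_mul_pow (hv i) (summable_abs_sum_mul hv c) r).hasSum.mul_left _

/-- The system is the Euler equation of the convex functional
`∑_k (∑_j c_j v_j(k))^(r+1) - (r+1) ∑_i c_i y_i`, which is coercive when the `v_j` are linearly
independent. -/
theorem exists_solution_of_odd (hv : ∀ j, Summable fun k => |v j k|) {r : ℕ}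
    (hr : Odd r)
    (hli : ∀ c : Fin n → ℝ, c ≠ 0 → ∃ k, ∑ j, c j * v j k ≠ 0) (y : Fin n → ℝ) :
    ∃ c : Fin n → ℝ, ∀ i, ∑' k, v i k * (∑ j, c j * v j k) ^ r = y i := by
  have hm : Even (r + 1) := hr.add_one
  set G : (Fin n → ℝ) → ℝ := fun c => ∑' k, (∑ j, c j * v j k) ^ (r + 1) with hG
  have hGs := fun c => (hasSum_pow_succ hv r c).summable
  have hGc : Continuous G := by
    have : G = fun c => ∑ i, c i * ∑' k, v i k * (∑ j, c j * v j k) ^ r :=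
      funext fun c => (hasSum_pow_succ hv r c).tsum_eq
    rw [this]
    exact continuous_finsetSum _ fun i _ =>
      (continuous_apply i).mul (continuous_tsum_mul_sum_pow hv (hv i) r)
  have hGpos : ∀ c, c ≠ 0 → 0 < G c := by
    intro c hc
    obtain ⟨k, hk⟩ := hli c hc
    exact (hGs c).tsum_pos (fun k => hm.pow_nonneg _) k (hm.pow_pos hk)
  have hGhom : ∀ (t : ℝ) c, G (t • c) = t ^ (r + 1) * G c := by
    intro t c
    simp only [hG, Pi.smul_apply, smul_eq_mul, mul_assoc, ← Finset.mul_sum, mul_pow, tsum_mul_left]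
  obtain ⟨δ, hδ, hδG⟩ := (isCompact_sphere (0 : Fin n → ℝ) 1).exists_forall_le' (a := 0)
    hGc.continuousOn (fun c hc => hGpos c (by
      rintro rfl
      simp at hc))
  set J : (Fin n → ℝ) → ℝ := fun c => G c - (r + 1) * ∑ i, c i * y i with hJ
  have hJc : Continuous J := by fun_prop
  have hJ0 : J 0 = 0 := by simp [hJ, hG]
  set L : ℝ := (r + 1) * ∑ i, |y i| with hL
  -- on the ball of radius `max 1 (L / δ)` the functional may be negative, outside it cannot
  have hJcoer : ∀ᶠ c in Filter.cocompact (Fin n → ℝ), J 0 ≤ J c := by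
    filter_upwards [(tendsto_norm_cocompact_atTop (E := Fin n → ℝ)).eventually_ge_atTop
      (max 1 (L / δ))] with c hc
    have hc1 : 1 ≤ ‖c‖ := (le_max_left _ _).trans hc
    have hc2 : L ≤ δ * ‖c‖ := by
      have := (le_max_right _ _).trans hc
      rwa [div_le_iff₀ hδ, mul_comm] at this
    have hc0 : 0 < ‖c‖ := by linarith
    have h1 : δ * ‖c‖ ^ (r + 1) ≤ G c := by
      have h2 := hδG (‖c‖⁻¹ • c) (by
        rw [mem_sphere_zero_iff_norm, norm_smul, norm_inv, norm_norm, inv_mul_cancel₀ hc0.ne'])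
      rw [hGhom, inv_pow, inv_mul_eq_div, le_div_iff₀ (by positivity)] at h2
      exact h2
    have h3 : ∑ i, c i * y i ≤ ‖c‖ * ∑ i, |y i| := by
      rw [Finset.mul_sum]
      refine Finset.sum_le_sum fun i _ => (le_abs_self _).trans ?_
      rw [abs_mul]
      gcongr
      exact norm_le_pi_norm c i
    have h4 : (r + 1) * ∑ i, c i * y i ≤ L * ‖c‖ := by
      calc _ ≤ ((r : ℝ) + 1) * (‖c‖ * ∑ i, |y i|) := by gcongr
        _ = L * ‖c‖ := by rw [hL]; ring
    have h5 : L * ‖c‖ ≤ δ * ‖c‖ ^ (r + 1) := by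
      calc L * ‖c‖ ≤ δ * ‖c‖ * ‖c‖ := by gcongr
        _ = δ * ‖c‖ ^ 2 := by ring
        _ ≤ δ * ‖c‖ ^ (r + 1) := by
          gcongr
          have := hr.pos
          omega
    rw [hJ0]
    simp only [hJ]
    linarith
  obtain ⟨c, hc⟩ := hJc.exists_forall_le' 0 hJcoer
  refine ⟨c, fun i => ?_⟩
  set u : ℕ → ℝ := fun k => ∑ j, c j * v j k with hu
  have hus : Summable fun k => |u k| := summable_abs_sum_mul hv c
  have hline : ∀ (t : ℝ) k,
      ∑ j, (c + t • (Pi.single i 1 : Fin n → ℝ)) j * v j k = u k + t * v i k := by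
    intro t k
    simp [add_mul, Finset.sum_add_distrib, hu, Pi.single_apply]
  have hderiv : HasDerivAt (fun t : ℝ => ∑' k, (u k + t * v i k) ^ (r + 1))
      (∑' k, (r + 1) * (v i k * u k ^ r)) 0 := by
    have hsum : Summable fun k => (r + 1) * (|v i k| * (|u k| + |v i k|) ^ r) := by
      refine (summable_mul_pow ?_ ?_ r).mul_left _
      · simpa using hv i
      · simpa [abs_of_nonneg, add_nonneg] using hus.add (hv i)
    have h0 : Summable fun k => (u k + 0 * v i k) ^ (r + 1) := by simpa using hGs c
    have h := hasDerivAt_tsum_of_isPreconnected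
      (g := fun k (t : ℝ) => (u k + t * v i k) ^ (r + 1))
      (g' := fun k t => (r + 1) * (v i k * (u k + t * v i k) ^ r)) (y₀ := 0) (y := 0)
      hsum (t := Metric.ball (0 : ℝ) 1) Metric.isOpen_ball
      (convex_ball (0 : ℝ) 1).isPreconnected
      (fun k t _ => by
        have := ((((hasDerivAt_id t).mul_const (v i k)).const_add (u k))).pow (r + 1)
        refine this.congr_deriv ?_
        simp; ring)
      (fun k t ht => by
        have ht1 : |t| ≤ 1 := by simpa using (mem_ball_zero_iff.1 ht).le
        rw [Real.norm_eq_abs, abs_mul, abs_mul, abs_pow,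
          abs_of_nonneg (by positivity : (0 : ℝ) ≤ r + 1)]
        gcongr
        refine (abs_add_le _ _).trans ?_
        rw [abs_mul]
        gcongr
        exact mul_le_of_le_one_left (abs_nonneg _) ht1)
      (by simp) h0 (by simp)
    simpa using h
  have hmin : IsLocalMin (fun t : ℝ => (∑' k, (u k + t * v i k) ^ (r + 1))
      - (r + 1) * (∑ j, c j * y j + t * y i)) 0 := by
    refine Filter.Eventually.of_forall fun t => ?_
    have h1 := hc (c + t • (Pi.single i 1 : Fin n → ℝ))
    have h2 : ∑ j, (c + t • (Pi.single i 1 : Fin n → ℝ)) j * y j = ∑ j, c j * y j + t * y i := by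
      simp [add_mul, Finset.sum_add_distrib, Pi.single_apply]
    simp only [hJ, hG, hline, h2] at h1
    simpa [hu] using h1
  have hlin : HasDerivAt (fun t : ℝ => ((r : ℝ) + 1) * (∑ j, c j * y j + t * y i))
      ((r + 1) * y i) 0 := by
    simpa using (((hasDerivAt_id (0 : ℝ)).mul_const (y i)).const_add
      (∑ j, c j * y j)).const_mul ((r : ℝ) + 1)
  have h0 := hmin.hasDerivAt_eq_zero (hderiv.sub hlin)
  rw [tsum_mul_left, ← mul_sub] at h0
  exact sub_eq_zero.1 ((mul_eq_zero.1 h0).resolve_left (by positivity))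

/-- Odd powers are strictly increasing, so the nonlinear map of the system is strictly monotone. -/
theorem solution_unique_of_odd (hv : ∀ j, Summable fun k => |v j k|) {r : ℕ}
    (hr : Odd r)
    (hli : ∀ c : Fin n → ℝ, c ≠ 0 → ∃ k, ∑ j, c j * v j k ≠ 0) {c c' : Fin n → ℝ}
    (h : ∀ i, ∑' k, v i k * (∑ j, c j * v j k) ^ r = ∑' k, v i k * (∑ j, c' j * v j k) ^ r) :
    c = c' := by
  set u : ℕ → ℝ := fun k => ∑ j, c j * v j k with hu
  set u' : ℕ → ℝ := fun k => ∑ j, c' j * v j k with hu'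
  have hus : Summable fun k => |u k| := summable_abs_sum_mul hv c
  have hus' : Summable fun k => |u' k| := summable_abs_sum_mul hv c'
  have hdiff : ∀ k, ∑ j, (c - c') j * v j k = u k - u' k := by
    intro k; simp [sub_mul, hu, hu']
  have hsum : HasSum (fun k => (u k - u' k) * (u k ^ r - u' k ^ r)) 0 := by
    have e : (fun k => (u k - u' k) * (u k ^ r - u' k ^ r))
        = fun k => ∑ i, (c - c') i * (v i k * u k ^ r - v i k * u' k ^ r) := by
      ext k
      rw [← hdiff, Finset.sum_mul]
      exact Finset.sum_congr rfl fun i _ => by ring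
    have h1 := hasSum_sum fun i (_ : i ∈ Finset.univ) =>
      ((summable_mul_pow (hv i) hus r).hasSum.sub
        (summable_mul_pow (hv i) hus' r).hasSum).mul_left ((c - c') i)
    have h0 : ∀ i, ∑' k, v i k * u k ^ r = ∑' k, v i k * u' k ^ r := h
    rw [e]
    simpa only [h0, sub_self, mul_zero, Finset.sum_const_zero] using h1
  have hmono := hr.strictMono_pow (R := ℝ)
  have hnn : ∀ k, 0 ≤ (u k - u' k) * (u k ^ r - u' k ^ r) := by
    intro k
    rcases le_total (u k) (u' k) with hk | hk
    · exact mul_nonneg_of_nonpos_of_nonpos (sub_nonpos.2 hk) (sub_nonpos.2 (hmono.monotone hk))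
    · exact mul_nonneg (sub_nonneg.2 hk) (sub_nonneg.2 (hmono.monotone hk))
  have hz := (hasSum_zero_iff_of_nonneg hnn).1 hsum
  by_contra hne
  obtain ⟨k, hk⟩ := hli (c - c') (sub_ne_zero.2 hne)
  rw [hdiff] at hk
  rcases mul_eq_zero.1 (congrFun hz k) with h1 | h1
  · exact hk h1
  · exact hk (sub_eq_zero.2 (hmono.injective (sub_eq_zero.1 h1)))

end Solve

/-! ### Interpolation in `B^p` -/

section Interpolant

variable {E : Type*} {φ : ℕ → E → ℝ} {n : ℕ} {X : Fin n → E}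

/-- The interpolant has the coefficients `u_k ^ (m - 1)` for `u = ∑_j c_j φ(X_j)`. -/
theorem hasSum_interpolant {m : ℕ} (hX : ∀ i, Summable fun k => |φ k (X i)|) (c : Fin n → ℝ)
    {x : E} (hx : Summable fun k => |φ k x|) :
    HasSum (fun k => φ k x * (∑ j, c j * φ k (X j)) ^ (m - 1)) (interpolant φ m X c x) := by
  convert hasSum_mul_sum_pow (r := m - 1) (w := fun k => φ k x) (v := fun j k => φ k (X j)) hx hX c
    using 1
  simp [interpolant, tensorContract, basisTensor, multiKernel, Fin.prod_univ_succ]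

theorem solvesSystem_iff {m : ℕ} {y c : Fin n → ℝ} :
    SolvesSystem φ m X y c ↔ ∀ i, interpolant φ m X c (X i) = y i := by
  rw [SolvesSystem, funext_iff]
  refine forall_congr' fun i => ?_
  simp [interpolant, tensorMulVec, tensorContract, basisTensor, kernelTensor, multiKernel,
    Fin.prod_univ_succ]

/-- Pairing the system with its solution, `‖u‖_m^m = ∑ α_k u_k` for `u = ∑_j c_j φ(X_j)`, so Young's
inequality bounds `‖u‖_m^m` by the norm of the data. -/
theorem hasSum_pow_le_of_interpolates {m : ℕ} (hm : 0 < m) (hmeven : Even m) {f : E → ℝ}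
    {α : ℕ → ℝ} (hα : Summable fun k => |α k| ^ ((m : ℝ) / (m - 1)))
    (hX : ∀ i, Summable fun k => |φ k (X i)|)
    (hf : ∀ i, HasSum (fun k => α k * φ k (X i)) (f (X i))) {c : Fin n → ℝ}
    (hc : ∀ i, interpolant φ m X c (X i) = f (X i)) :
    (Summable fun k => (∑ j, c j * φ k (X j)) ^ m) ∧
      ∑' k, (∑ j, c j * φ k (X j)) ^ m ≤ ∑' k, |α k| ^ ((m : ℝ) / (m - 1)) := by
  have hm2 : 2 ≤ m := by rcases hmeven with ⟨a, rfl⟩; omega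
  set u : ℕ → ℝ := fun k => ∑ j, c j * φ k (X j) with hu
  have hm1 : m - 1 + 1 = m := by omega
  have h1 := hasSum_pow_succ (v := fun j k => φ k (X j)) hX (m - 1) c
  have h2 : ∀ i, ∑' k, φ k (X i) * (∑ j, c j * φ k (X j)) ^ (m - 1) = f (X i) := fun i => by
    rw [(hasSum_interpolant hX c (hX i)).tsum_eq, hc]
  simp only [h2, hm1] at h1
  have h3 : HasSum (fun k => α k * u k) (∑ i, c i * f (X i)) := by
    have e : (fun k => α k * u k) = fun k => ∑ i, c i * (α k * φ k (X i)) := by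
      ext k
      rw [hu, Finset.mul_sum]
      exact Finset.sum_congr rfl fun i _ => by ring
    rw [e]
    exact hasSum_sum fun i _ => (hf i).mul_left _
  have hmR : (1 : ℝ) < m := by exact_mod_cast hm2
  have hpq : ((m : ℝ) / (m - 1)).HolderConjugate m :=
    (Real.HolderConjugate.conjExponent hmR).symm
  have hle := hasSum_le (fun k => by
    have := Real.young_inequality (α k) (u k) hpq
    rwa [Real.rpow_natCast, hmeven.pow_abs] at this) h3
    ((hα.hasSum.div_const ((m : ℝ) / (m - 1))).add (h1.div_const (m : ℝ)))
  refine ⟨h1.summable, ?_⟩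
  rw [h1.tsum_eq]
  set U := ∑ i, c i * f (X i)
  set A := ∑' k, |α k| ^ ((m : ℝ) / (m - 1))
  have hm0 : (0 : ℝ) < m := by linarith
  have hmm : (0 : ℝ) < m - 1 := by linarith
  rw [div_div_eq_mul_div, ← add_div, le_div_iff₀ hm0] at hle
  nlinarith

/-- The coefficients `u_k ^ (m - 1)` of the interpolant are square summable, with a bound in terms
of `‖u‖_m^m` only. -/
theorem sum_sq_le_of_tsum_pow_le {m : ℕ} (hm : 0 < m) (hmeven : Even m) {u : ℕ → ℝ} {A : ℝ}
    (hu : Summable fun k => u k ^ m) (hA : ∑' k, u k ^ m ≤ A) (s : Finset ℕ) :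
    ∑ k ∈ s, (u k ^ (m - 1)) ^ 2 ≤ A * (1 + A) := by
  obtain ⟨a, rfl⟩ := hmeven
  have hev : Even (a + a) := ⟨a, rfl⟩
  have hle : ∀ k, u k ^ (a + a) ≤ A := fun k =>
    (hu.le_tsum k fun _ _ => hev.pow_nonneg _).trans hA
  have hA0 : 0 ≤ A := (hev.pow_nonneg (u 0)).trans (hle 0)
  have hterm : ∀ k, (u k ^ (a + a - 1)) ^ 2 ≤ u k ^ (a + a) * (1 + A) := by
    intro k
    have e : (u k ^ (a + a - 1)) ^ 2 = u k ^ (a + a) * (u k ^ 2) ^ (a - 1) := by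
      rw [← pow_mul, ← pow_mul, ← pow_add]
      congr 1; omega
    rw [e]
    refine mul_le_mul_of_nonneg_left ?_ (hev.pow_nonneg _)
    -- `t ^ (a - 1) ≤ 1 + t ^ a` for `t ≥ 0`
    rcases le_total (u k ^ 2) 1 with h | h
    · exact (pow_le_one₀ (sq_nonneg _) h).trans (by linarith)
    · calc (u k ^ 2) ^ (a - 1) ≤ (u k ^ 2) ^ a := pow_le_pow_right₀ h (by omega)
        _ = u k ^ (a + a) := by rw [← pow_mul]; congr 1; omega
        _ ≤ 1 + A := (hle k).trans (by linarith)
  calc ∑ k ∈ s, (u k ^ (a + a - 1)) ^ 2 ≤ ∑ k ∈ s, u k ^ (a + a) * (1 + A) :=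
        Finset.sum_le_sum fun k _ => hterm k
    _ = (∑ k ∈ s, u k ^ (a + a)) * (1 + A) := by rw [Finset.sum_mul]
    _ ≤ A * (1 + A) := by
        gcongr
        exact (hu.sum_le_tsum s fun _ _ => hev.pow_nonneg _).trans hA

end Interpolant

/-- The sequences `k ↦ φ_k(X_j)` are linearly independent, since by Mercer's expansion the quadratic
form of the kernel is the squared `ℓ²` norm of their combination. -/
theorem IsPosDefKernel.exists_sum_ne_zero {d : ℕ} {Ω : Set (EuclideanSpace ℝ (Fin d))}
    {Φ : EuclideanSpace ℝ (Fin d) → EuclideanSpace ℝ (Fin d) → ℝ} (h : IsPosDefKernel Ω Φ)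
    {φ : ℕ → EuclideanSpace ℝ (Fin d) → ℝ}
    (hφ : ∀ x ∈ Ω, ∀ y ∈ Ω, HasSum (fun k => φ k x * φ k y) (Φ x y)) {n : ℕ}
    {X : Fin n → EuclideanSpace ℝ (Fin d)} (hinj : Function.Injective X) (hX : ∀ i, X i ∈ Ω)
    (c : Fin n → ℝ) (hc : c ≠ 0) : ∃ k, ∑ j, c j * φ k (X j) ≠ 0 := by
  by_contra! hcon
  have h1 := hasSum_sq_sum X c fun p q => hφ _ (hX p) _ (hX q)
  simp only [hcon, ne_eq, OfNat.ofNat_ne_zero, not_false_eq_true, zero_pow] at h1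
  refine (h.2 n X hinj hX c hc).ne ?_
  rw [hasSum_zero.unique h1]
  exact Finset.sum_congr rfl fun p _ => Finset.sum_congr rfl fun q _ => by ring

theorem mainTheorem4 {d : ℕ} (Ω : Set (EuclideanSpace ℝ (Fin d)))
    (hΩ : IsCompact Ω) (hcone : InteriorConeCondition Ω)
    (Φ : EuclideanSpace ℝ (Fin d) → EuclideanSpace ℝ (Fin d) → ℝ)
    (hΦcont : ContinuousOn (Function.uncurry Φ) (Ω ×ˢ Ω))
    (hΦpd : IsPosDefKernel Ω Φ)
    (lam : ℕ → ℝ) (e : ℕ → EuclideanSpace ℝ (Fin d) → ℝ)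
    (heig : IsEigenSystem Ω Φ lam e)
    (hsum : ∀ x ∈ Ω, Summable fun k => |featureMap lam e k x|)
    (m : ℕ) (hm : 0 < m) (hmeven : Even m)
    (γ : ℕ) (hΦsmooth : ContDiffOn ℝ ((2 * γ : ℕ) : WithTop ℕ∞) (Function.uncurry Φ) (Ω ×ˢ Ω))
    (f : EuclideanSpace ℝ (Fin d) → ℝ)
    (hf : MemRKBS Ω (featureMap lam e) ((m : ℝ) / ((m : ℝ) - 1)) f) :
    ∃ C : ℝ, 0 < C ∧
      ∀ (n : ℕ), 0 < n → ∀ X : Fin n → EuclideanSpace ℝ (Fin d),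
        Function.Injective X → (∀ i, X i ∈ Ω) →
        (∃! c : Fin n → ℝ, SolvesSystem (featureMap lam e) m X (fun i => f (X i)) c) ∧
        ∀ c : Fin n → ℝ, SolvesSystem (featureMap lam e) m X (fun i => f (X i)) c →
          ∀ x ∈ Ω, |f x - interpolant (featureMap lam e) m X c x| ≤ C * fillDistance Ω X ^ γ := by
  obtain ⟨c₀, r, hc0, hc1, hr, hcones⟩ := hcone.hasInteriorCones
  have hmercer := fun x (hx : x ∈ Ω) y (hy : y ∈ Ω) =>
    hasSum_featureMap_mul hΩ (hcones.subset_closure_interior hc0 hc1 hr) hΦcont heig hx hy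
  obtain ⟨α, hα, hαf⟩ := hf
  have hm2 : 2 ≤ m := by rcases hmeven with ⟨a, rfl⟩; omega
  have hmR : (2 : ℝ) ≤ m := by exact_mod_cast hm2
  set p : ℝ := (m : ℝ) / ((m : ℝ) - 1) with hp
  have hp0 : 0 < p := div_pos (by linarith) (by linarith)
  have hαp : Summable fun k => |α k| ^ p := by
    have := hα.summable (by rwa [ENNReal.toReal_ofReal hp0.le])
    simpa only [ENNReal.toReal_ofReal hp0.le, Real.norm_eq_abs] using this
  have hα2 : Summable fun k => α k ^ 2 := by
    have h2 : Memℓp α 2 := hα.of_exponent_ge (by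
      rw [show (2 : ENNReal) = ENNReal.ofReal 2 by simp]
      refine ENNReal.ofReal_le_ofReal ?_
      rw [hp, div_le_iff₀ (by linarith)]; linarith)
    simpa using h2.summable (by simp)
  set A := ∑' k, |α k| ^ p with hA
  -- bound for `‖α - β‖²` in `ℓ²`, where `β` are the coefficients of any interpolant
  set D := 2 * (∑' k, α k ^ 2) + 2 * (A * (1 + A)) with hD
  obtain ⟨C, hC, hbound⟩ := exists_sampling_bound hΩ hc0 hc1 hr hcones hΦsmooth hmercer D
  refine ⟨C, hC, fun n hn X hinj hX => ⟨?_, fun c hc x hx => ?_⟩⟩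
  · have hv := fun i => hsum (X i) (hX i)
    have hli := hΦpd.exists_sum_ne_zero hmercer hinj hX
    have hodd : Odd (m - 1) := Nat.Even.sub_odd hm hmeven odd_one
    have htsum : ∀ c i, interpolant (featureMap lam e) m X c (X i)
        = ∑' k, featureMap lam e k (X i) * (∑ j, c j * featureMap lam e k (X j)) ^ (m - 1) :=
      fun c i => (hasSum_interpolant hv c (hv i)).tsum_eq.symm
    simp only [solvesSystem_iff, htsum]
    obtain ⟨c, hc⟩ := exists_solution_of_odd (v := fun j k => featureMap lam e k (X j)) hv hodd hli
      fun i => f (X i)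
    exact ⟨c, hc, fun c' hc' => solution_unique_of_odd
      (v := fun j k => featureMap lam e k (X j)) hv hodd hli fun i => (hc' i).trans (hc i).symm⟩
  · rw [solvesSystem_iff] at hc
    have hv := fun i => hsum (X i) (hX i)
    obtain ⟨hus, huA⟩ := hasSum_pow_le_of_interpolates hm hmeven hαp hv
      (fun i => hαf (X i) (hX i)) hc
    refine hbound n hn X hX
      (fun k => α k - (∑ j, c j * featureMap lam e k (X j)) ^ (m - 1)) (fun s => ?_)
      (fun x => f x - interpolant (featureMap lam e) m X c x) (fun z hz => ?_)
      (fun i => by rw [hc, sub_self]) x hx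
    · have h1 := sum_sq_le_of_tsum_pow_le hm hmeven hus huA s
      have h2 := hα2.sum_le_tsum s fun k _ => sq_nonneg (α k)
      calc _ ≤ ∑ k ∈ s, (2 * α k ^ 2
              + 2 * ((∑ j, c j * featureMap lam e k (X j)) ^ (m - 1)) ^ 2) :=
            Finset.sum_le_sum fun k _ => by
              nlinarith [sq_nonneg (α k + (∑ j, c j * featureMap lam e k (X j)) ^ (m - 1))]
        _ ≤ D := by
            rw [Finset.sum_add_distrib, ← Finset.mul_sum, ← Finset.mul_sum]
            linarith
    · have h1 := (hαf z hz).sub (hasSum_interpolant (m := m) hv c (hsum z hz))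
      simpa only [sub_mul, mul_comm (featureMap lam e _ z)] using h1
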